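/- Conventions. All presentations are of finite type. A discrete presentation consists of a free group $F$ of finite rank and a finite set of relators $S\subset F$; put $R=\langle\langle S\rangle\rangle$, the normal closure of $S$. A pro-$p$ presentation ($p$ a fixed prime) of a pro-$p$ group $G$ is an exact sequence $1\to R\to F\to G\to 1$ of pro-$p$ groups with $F$ a free pro-$p$ group of finite rank; given by a finite set of relators $S\subset F$, it has as $R$ the closed normal subgroup generated by $S$. A subpresentation has the same $F$ and a subset $S'\subseteq S$ as set of relators. In the pro-$p$ case commutator subgroups are closed. Let $\mathcal M_n=\{f\in F: f-1\in\Delta_p^n\}$ be the Zassenhaus $p$-filtration of $F$, where $\Delta_p$ is the augmentation ideal of $\mathbb F_p[F]$ (of the completed group algebra $\mathbb F_p[[F]]$ in the pro-$p$ case). The presentation is *quasirational* if $R/[R,R\mathcal M_n]$ has no $p$-torsion for all $n>0$ (and for all primes $p$ in the discrete case). A discrete presentation with relators $S$ is *combinatorially aspherical* if every finite sequence of $F$-conjugates of elements of $S\cup S^{-1}$ with product $1$ in $F$ can be transformed into the empty sequence by exchanges $(a,b)\mapsto(aba^{-1},a)$ and $(a,b)\mapsto(b,b^{-1}ab)$ of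 neighbours, and by deletions and insertions of neighbours $(a,a^{-1})$, where $a$ is a conjugate of an element of $S\cup S^{-1}$. The relation module $\overline R=R/[R,R]$ of a pro-$p$ presentation of $G$ is *permutational* if it has a closed $G$-invariant subset $T$ that is a profinite basis of $\overline R$ over $\mathbb Z_p$, that is $\overline R\cong\mathbb Z_p[[T]]$. A pro-$p$ presentation with relators $S$ is *aspherical* if $\overline R$ is the direct sum of the submodules topologically generated by the $G$-orbits of $\overline r=r[R,R]$, $r\in S$, where the submodule belonging to $r$ is $\mathbb Z_p[[G/\overline{\langle \pi(s_r)\rangle}]]$ with canonical generator $\overline r$; here $\pi:F\to G$ is the projection and $s_r$ is the root of $r$ in $F$ ($r=s_r^{p^k}$ for some $k\ge 0$, and $s_r$ is not a $p$-th power). Proposition. (i) A combinatorially aspherical discrete presentation and all its subpresentations are quasirational. An aspherical pro-$p$ presentation and all its subpresentations are quasirational. Moreover every pro-$p$ presentation with a permutational relation module is quasirational. (ii) If one pro-$p$ presentation of a pro-$p$ group $G$ is quasirational, then every pro-$p$ presentation of $G$ is quasirational. -/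

import Mathlib

universe u v w

/-! ### The Zassenhaus filtration -/

/-- The augmentation `𝔽_p[F] → 𝔽_p`, `f ↦ 1` for `f ∈ F`. -/
noncomputable def augmentation (p : ℕ) (F : Type u) [Group F] :
    MonoidAlgebra (ZMod p) F →ₐ[ZMod p] ZMod p :=
  MonoidAlgebra.lift (ZMod p) (ZMod p) F (1 : F →* ZMod p)

/-- The augmentation ideal `Δ_p = ker (𝔽_p[F] → 𝔽_p)`. -/
noncomputable def augmentationIdeal (p : ℕ) (F : Type u) [Group F] :
    Ideal (MonoidAlgebra (ZMod p) F) :=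
  RingHom.ker (augmentation p F)

instance augmentationIdeal_isTwoSided (p : ℕ) (F : Type u) [Group F] :
    (augmentationIdeal p F).IsTwoSided := by
  unfold augmentationIdeal
  infer_instance

/-- The `n`-th term `{f ∈ F | f - 1 ∈ Δ_p ^ n}` of the Zassenhaus `p`-filtration of a discrete
group `F`. -/
noncomputable def zassenhaus (p : ℕ) (F : Type u) [Group F] (n : ℕ) : Subgroup F where
  carrier := {f | MonoidAlgebra.of (ZMod p) F f - 1 ∈ augmentationIdeal p F ^ n}
  one_mem' := by
    rw [Set.mem_ofPred_eq, map_one, sub_self]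
    exact Ideal.zero_mem _
  mul_mem' := by
    intro a b ha hb
    have h : MonoidAlgebra.of (ZMod p) F (a * b) - 1 =
        MonoidAlgebra.of (ZMod p) F a * (MonoidAlgebra.of (ZMod p) F b - 1) +
          (MonoidAlgebra.of (ZMod p) F a - 1) := by
      rw [map_mul]; noncomm_ring
    simp only [Set.mem_ofPred_eq] at ha hb ⊢
    rw [h]
    exact Ideal.add_mem _ (Ideal.mul_mem_left _ _ hb) ha
  inv_mem' := by
    intro a ha
    have h : MonoidAlgebra.of (ZMod p) F a⁻¹ - 1 =
        -(MonoidAlgebra.of (ZMod p) F a⁻¹ * (MonoidAlgebra.of (ZMod p) F a - 1)) := by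
      rw [mul_sub, ← map_mul, inv_mul_cancel, map_one, mul_one, neg_sub]
    simp only [Set.mem_ofPred_eq] at ha ⊢
    rw [h]
    exact Ideal.neg_mem_iff _ |>.2 (Ideal.mul_mem_left _ _ ha)

/-- The `n`-th term `{f ∈ F | f - 1 ∈ Δ_p ^ n}` of the Zassenhaus `p`-filtration of a pro-`p`
group `F`. Here `Δ_p` is the augmentation ideal of the completed group algebra
`𝔽_p⟦F⟧ = lim 𝔽_p[F ⧸ U]` (`U` open normal) and `Δ_p ^ n` its closed power, so that membership
is tested in all the finite quotients `F ⧸ U`. -/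
noncomputable def proPZassenhaus (p : ℕ) (F : Type u) [Group F] [TopologicalSpace F] (n : ℕ) :
    Subgroup F :=
  ⨅ U : OpenNormalSubgroup F,
    (zassenhaus p (F ⧸ U.toSubgroup) n).comap (QuotientGroup.mk' U.toSubgroup)

/-! ### Quasirational presentations -/

/-- The discrete presentation `1 → R → F → F ⧸ R → 1` is quasirational: for all `n > 0` and all
primes `p`, the abelian group `R / [R, R M_n]` (`M_n` the `p`-Zassenhaus filtration of `F`) has
no element of order `p`. -/
def IsQuasirational {F : Type u} [Group F] (R : Subgroup F) : Prop :=
  ∀ p : ℕ, p.Prime → ∀ n : ℕ, 0 < n → ∀ x ∈ R,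
    x ^ p ∈ ⁅R, R ⊔ zassenhaus p F n⁆ → x ∈ ⁅R, R ⊔ zassenhaus p F n⁆

/-- The pro-`p` presentation `1 → R → F → F ⧸ R → 1` is quasirational: for all `n > 0` the abelian
pro-`p` group `R / [R, R M_n]` (closed commutator subgroup) has no element of order `p`. -/
def IsProPQuasirational (p : ℕ) {F : Type u} [Group F] [TopologicalSpace F]
    [IsTopologicalGroup F] (R : Subgroup F) : Prop :=
  ∀ n : ℕ, 0 < n → ∀ x ∈ R,
    x ^ p ∈ ⁅R, R ⊔ proPZassenhaus p F n⁆.topologicalClosure →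
      x ∈ ⁅R, R ⊔ proPZassenhaus p F n⁆.topologicalClosure

/-! ### Combinatorially aspherical discrete presentations -/

/-- The set of all conjugates of relators `r ∈ S` and of their inverses. -/
def relatorConjugates {F : Type u} [Group F] (S : Set F) : Set F :=
  {a | ∃ r ∈ S, IsConj r a ∨ IsConj r⁻¹ a}

/-- The Peiffer operations on finite sequences of conjugates of relators and inverse relators:
the two exchanges and the deletion of adjacent inverse pairs (an insertion is the reverse of a
deletion). -/
inductive PeifferStep {F : Type u} [Group F] (S : Set F) : List F → List F → Prop
  | exchange (l₁ l₂ : List F) (a b : F) :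
      PeifferStep S (l₁ ++ a :: b :: l₂) (l₁ ++ (a * b * a⁻¹) :: a :: l₂)
  | exchange' (l₁ l₂ : List F) (a b : F) :
      PeifferStep S (l₁ ++ a :: b :: l₂) (l₁ ++ b :: (b⁻¹ * a * b) :: l₂)
  | deletion (l₁ l₂ : List F) (a : F) (ha : a ∈ relatorConjugates S) :
      PeifferStep S (l₁ ++ a :: a⁻¹ :: l₂) (l₁ ++ l₂)

/-- The presentation with free group `F` and set of relators `S` is combinatorially aspherical
(CA): every identity sequence, i.e. every finite sequence of conjugates of relators and inverse
relators whose product in `F` is `1`, can be transformed into the empty sequence by Peiffer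
exchanges, deletions and insertions. -/
def IsCombinatoriallyAspherical {F : Type u} [Group F] (S : Set F) : Prop :=
  ∀ l : List F, (∀ a ∈ l, a ∈ relatorConjugates S) → l.prod = 1 →
    Relation.EqvGen (PeifferStep S) l []

/-! ### Free pro-`p` groups and pro-`p` presentations -/

/-- `F` is a pro-`p` group. -/
structure IsProP (p : ℕ) (F : Type u) [Group F] [TopologicalSpace F] [IsTopologicalGroup F] :
    Prop where
  compact : CompactSpace F
  hausdorff : T2Space F
  totallyDisconnected : TotallyDisconnectedSpace F
  isPGroup_quotient : ∀ U : OpenNormalSubgroup F, IsPGroup p (F ⧸ U.toSubgroup)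

/-- `F` is a free pro-`p` group of finite rank: it is a pro-`p` group and there are
`x₁, …, x_d ∈ F` such that every map from `{x₁, …, x_d}` to a finite `p`-group extends to a unique
continuous homomorphism. -/
def IsFreeProPOfFiniteRank (p : ℕ) (F : Type u) [Group F] [TopologicalSpace F]
    [IsTopologicalGroup F] : Prop :=
  IsProP p F ∧ ∃ (d : ℕ) (x : Fin d → F),
    ∀ (P : Type) [Group P] [Finite P], IsPGroup p P → ∀ g : Fin d → P,
      ∃! φ : F →* P, IsLocallyConstant φ ∧ ∀ i, φ (x i) = g i

/-- The closed normal subgroup generated by a set of relators. -/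
def closedNormalClosure {F : Type u} [Group F] [TopologicalSpace F] [IsTopologicalGroup F]
    (S : Set F) : Subgroup F :=
  (Subgroup.normalClosure S).topologicalClosure

instance closedNormalClosure_normal {F : Type u} [Group F] [TopologicalSpace F]
    [IsTopologicalGroup F] (S : Set F) : (closedNormalClosure S).Normal :=
  Subgroup.is_normal_topologicalClosure _

theorem conj_mem_closedNormalClosure {F : Type u} [Group F] [TopologicalSpace F]
    [IsTopologicalGroup F] (S : Set F) (r : S) (f : F) :
    f * (r : F) * f⁻¹ ∈ closedNormalClosure S :=
  (closedNormalClosure_normal S).conj_mem _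
    (Subgroup.le_topologicalClosure _ (Subgroup.subset_normalClosure r.2)) f

/-- The relation module `R / [R, R]` of a pro-`p` presentation (closed commutator subgroup), an
abelian pro-`p` group, written multiplicatively. -/
abbrev RelationModule {F : Type u} [Group F] [TopologicalSpace F] [IsTopologicalGroup F]
    (R : Subgroup F) : Type u :=
  TopologicalAbelianization R

/-- The subset `T` of the (multiplicative) abelian pro-`p` group `A` is a profinite basis of `A` as
`ℤ_p`-module, i.e. `A = ℤ_p⟦T⟧`: every continuous map from `T` to a finite cyclic `p`-group extends
to a unique continuous homomorphism on `A`. -/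
def IsProfiniteBasis (p : ℕ) {A : Type u} [CommGroup A] [TopologicalSpace A] (T : Set A) : Prop :=
  ∀ (k : ℕ) (h : T → ZMod (p ^ k)), IsLocallyConstant h →
    ∃! φ : A →* Multiplicative (ZMod (p ^ k)),
      IsLocallyConstant φ ∧ ∀ t : T, φ t = Multiplicative.ofAdd (h t)

/-- The relation module of the pro-`p` presentation `1 → R → F → F ⧸ R → 1` is permutational: it
has a closed profinite basis over `ℤ_p` that is invariant under the conjugation action of `F`
(which is the action of `F ⧸ R`). -/
def IsPermutationalRelationModule (p : ℕ) {F : Type u} [Group F] [TopologicalSpace F]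
    [IsTopologicalGroup F] (R : Subgroup F) [R.Normal] : Prop :=
  ∃ T : Set (RelationModule R), IsClosed T ∧ IsProfiniteBasis p T ∧
    ∀ (f : F) (x : R), (QuotientGroup.mk x : RelationModule R) ∈ T →
      (QuotientGroup.mk (MulAut.conjNormal f x) : RelationModule R) ∈ T

/-- The class `f · r̄` of `f r f⁻¹` in the relation module of the presentation with relators `S`. -/
def relatorClass {F : Type u} [Group F] [TopologicalSpace F] [IsTopologicalGroup F] (S : Set F)
    (r : S) (f : F) : RelationModule (closedNormalClosure S) :=
  QuotientGroup.mk ⟨f * (r : F) * f⁻¹, conj_mem_closedNormalClosure S r f⟩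

/-- `s` is the root of `r` in the free pro-`p` group `F`: `r = s ^ (p ^ k)`, and `s` is not a
`p`-th power. -/
def IsProPRoot (p : ℕ) {F : Type u} [Group F] (s r : F) : Prop :=
  (∃ k : ℕ, r = s ^ p ^ k) ∧ ¬ ∃ t : F, t ^ p = s

/-- The pro-`p` presentation with free pro-`p` group `F` and relators `S` is aspherical: with `R`
the closed normal subgroup generated by `S` and `G = F ⧸ R`, the relation module `R / [R, R]` is
the direct sum over `r ∈ S` of the permutation modules `ℤ_p⟦G ⧸ ⟨s_r⟩⟧` generated by the classes
`r̄`, where `s_r` is the root of `r`. That is, the translates of the `r̄` form a profinite basis,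
distinct relators have disjoint orbits, and the stabilizer of `r̄` in `G` is the closed subgroup
generated by the image of `s_r` (which always fixes `r̄`). -/
def IsProPAspherical (p : ℕ) {F : Type u} [Group F] [TopologicalSpace F] [IsTopologicalGroup F]
    (S : Set F) : Prop :=
  IsProfiniteBasis p (Set.range fun a : S × F => relatorClass S a.1 a.2) ∧
  ∀ r : S, ∃ s : F, IsProPRoot p s (r : F) ∧
    ∀ (r' : S) (f : F), relatorClass S r f = relatorClass S r' 1 →
      r' = r ∧ f ∈ closedNormalClosure S ⊔ (Subgroup.zpowers s).topologicalClosure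

/-!
Quasirationality is detected by characters, i.e. locally constant homomorphisms `R → ℤ/p^k`. The
elements of order `p` in `R / [R, N]`, where `N = R M_n`, are separated from `1` by `N`-invariant
characters (`exists_isCharOn_ne_zero`, `IsProP.charsSeparate`). Hence there are none if every
`N`-invariant character modulo `p^k` lifts to one modulo `p^(k+1)`: for a lift `θ'` of `θ`,
`x ^ p ∈ [R, N]` gives `p θ'(x) = 0` and so `θ(x) = 0` (`mem_of_pow_mem_of_charsLift`).

A permutational relation module allows one to lift a character by lifting its values on the
invariant basis (`charsLift_of_isPermutational`). For a subset `S'` of an aspherical set `S` of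
relators, with normal closures `R' ≤ R`, the values of a character of `R'` on the conjugates of
`S'` are lifted instead. Asphericity says that an `R`-invariant function on the conjugates of `S'`,
extended by `0` to the conjugates of the other relators, is the restriction of a character of `R`
(`IsProPAspherical.charExtends`). In the discrete case the sum of an odd invariant function over a
sequence of conjugates of relators does not change under Peiffer operations, so that it depends
only on the product (`IsCombinatoriallyAspherical.exists_isCharOn`); odd functions with prescribed
values exist because a nontrivial element of a free group is not conjugate to its inverse
(`FreeGroup.eq_one_of_conj_eq_inv`).

The lifted values, however, are invariant only under a subgroup `L` with `R' ≤ L ≤ R` of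
`p`-power index in `R`, so the extension property has to descend from `R` to `L`. This is
`CharExtends.of_relIndex_eq_prime`, for index `p`. In characteristic `p` the norm of
`⟨t⟩ = L₁ / L` equals `(T - 1) ^ (p - 1)`, where `T` is the action of `t`, and every character of
`L₁` restricts on `L` to the norm of a character of `L`, by lifting to the wreath product of `ℤ/p`
with `L₁ / L`. Induction on the least `k` with `(T - 1) ^ k h = 0` then extends any function `h`.
The passage from `p` to `p^k` is by successive approximation (`CharExtends.prime_pow`).
Both steps use that homomorphisms from `L` to finite `p`-groups lift along surjections. For
subgroups of free groups this is the Nielsen–Schreier theorem; for subgroups of free pro-`p` groups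
it follows by inducing up to a wreath product with a permutation group
(`IsFreeProPOfFiniteRank.hasPLifting`).

For the independence of the presentation, the identity of `G` is lifted to `α : F₁ → F₂` and
`β : F₂ → F₁`. If `x ∈ R₂` has order `p` modulo `[R₂, N₂]`, then `α (β x) ∈ [R₂, N₂]` because the
first presentation is quasirational. The deviation `n ↦ n⁻¹ α (β n)` is a homomorphism from `N₂` to
the abelian group `R₂ / [R₂, N₂]`. It is trivial on `x`, since the abelianization of the closed
subgroup `N₂` of a free pro-`p` group is torsion-free. Hence `x ∈ [R₂, N₂]`
(`IsProPQuasirational.of_presentation`).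
-/

open Filter Topology

/-! ### Characters of subgroups -/

section LocConstOn

variable {F : Type u} [TopologicalSpace F]

/-- The function `f` is locally constant on the subset `s` (in the subspace topology). -/
def LocConstOn {C : Type*} (s : Set F) (f : F → C) : Prop :=
  ∀ x ∈ s, ∀ᶠ y in 𝓝[s] x, f y = f x

theorem LocConstOn.mono {C : Type*} {s t : Set F} {f : F → C} (h : LocConstOn t f) (hst : s ⊆ t) :
    LocConstOn s f :=
  fun x hx => (h x (hst hx)).filter_mono (nhdsWithin_mono x hst)

theorem LocConstOn.map {C D : Type*} {s : Set F} {f : F → C} (h : LocConstOn s f) (g : C → D) :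
    LocConstOn s (fun x => g (f x)) := by
  intro x hx
  filter_upwards [h x hx] with y hy
  rw [hy]

theorem LocConstOn.map₂ {C D E : Type*} {s : Set F} {f : F → C} {f' : F → D} (h : LocConstOn s f)
    (h' : LocConstOn s f') (g : C → D → E) : LocConstOn s (fun x => g (f x) (f' x)) := by
  intro x hx
  filter_upwards [h x hx, h' x hx] with y hy hy'
  rw [hy, hy']

theorem LocConstOn.comp {C : Type*} {G : Type v} [TopologicalSpace G] {s : Set F}
    {t : Set G} {f : G → C} (h : LocConstOn t f) {c : F → G} (hc : ContinuousOn c s)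
    (hst : Set.MapsTo c s t) : LocConstOn s (fun x => f (c x)) := by
  intro x hx
  exact ((hc x hx).tendsto_nhdsWithin hst).eventually (h (c x) (hst hx))

theorem locConstOn_iff {C : Type*} {s : Set F} {f : F → C} :
    LocConstOn s f ↔ IsLocallyConstant (fun x : s => f x) := by
  rw [IsLocallyConstant.iff_eventually_eq]
  constructor
  · rintro h ⟨x, hx⟩
    have := h x hx
    rw [nhdsWithin_eq_map_subtype_coe hx] at this
    exact this
  · intro h x hx
    rw [nhdsWithin_eq_map_subtype_coe hx]
    exact h ⟨x, hx⟩

end LocConstOn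

section Characters

variable {F : Type u} [Group F] [TopologicalSpace F]

/-- The restriction of `f` to the subgroup `L` is a locally constant homomorphism to the additive
group `C`. The values of `f` outside `L` are irrelevant. -/
structure IsCharOn {C : Type*} [AddCommGroup C] (L : Subgroup F) (f : F → C) : Prop where
  map_mul : ∀ x ∈ L, ∀ y ∈ L, f (x * y) = f x + f y
  locConst : LocConstOn (L : Set F) f

/-- Every function on `A` that is locally constant and invariant under conjugation by `L` is the
restriction of a character `L → ℤ/n`. -/
def CharExtends (A : Set F) (L : Subgroup F) (n : ℕ) : Prop :=
  ∀ h : F → ZMod n, LocConstOn A h → (∀ l ∈ L, ∀ a ∈ A, h (l * a * l⁻¹) = h a) →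
    ∃ φ : F → ZMod n, IsCharOn L φ ∧ ∀ a ∈ A, φ a = h a

/-- Locally constant homomorphisms from `L` to finite `p`-groups can be lifted along surjections of
finite `p`-groups. -/
def HasPLifting (p : ℕ) (L : Type u) [Group L] [TopologicalSpace L] : Prop :=
  ∀ (E B : Type) [Group E] [Finite E] [Group B], IsPGroup p E → ∀ π : E →* B,
    Function.Surjective π → ∀ φ : L →* B, IsLocallyConstant φ →
      ∃ ψ : L →* E, IsLocallyConstant ψ ∧ ∀ x, π (ψ x) = φ x

namespace IsCharOn

variable {C : Type*} [AddCommGroup C] {L : Subgroup F} {f g : F → C}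

theorem map_one (h : IsCharOn L f) : f 1 = 0 := by
  have := h.map_mul 1 L.one_mem 1 L.one_mem
  simpa using this

theorem map_inv (h : IsCharOn L f) {x : F} (hx : x ∈ L) : f x⁻¹ = -f x := by
  have := h.map_mul x hx x⁻¹ (L.inv_mem hx)
  rw [mul_inv_cancel, h.map_one] at this
  exact (neg_eq_of_add_eq_zero_right this.symm).symm

theorem map_pow (h : IsCharOn L f) {x : F} (hx : x ∈ L) (n : ℕ) : f (x ^ n) = n • f x := by
  induction n with
  | zero => simp [h.map_one]
  | succ n ih => rw [pow_succ, h.map_mul _ (L.pow_mem hx n) _ hx, ih, succ_nsmul]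

theorem map_conj (h : IsCharOn L f) {x y : F} (hx : x ∈ L) (hy : y ∈ L) :
    f (y * x * y⁻¹) = f x := by
  rw [h.map_mul _ (L.mul_mem hy hx) _ (L.inv_mem hy), h.map_mul _ hy _ hx, h.map_inv hy]
  abel

theorem mono (h : IsCharOn L f) {L' : Subgroup F} (hL : L' ≤ L) : IsCharOn L' f :=
  ⟨fun x hx y hy => h.map_mul x (hL hx) y (hL hy), h.locConst.mono hL⟩

theorem add (hf : IsCharOn L f) (hg : IsCharOn L g) : IsCharOn L (f + g) := by
  refine ⟨fun x hx y hy => ?_, hf.locConst.map₂ hg.locConst (· + ·)⟩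
  simp only [Pi.add_apply, hf.map_mul x hx y hy, hg.map_mul x hx y hy]
  abel

theorem sub (hf : IsCharOn L f) (hg : IsCharOn L g) : IsCharOn L (f - g) := by
  refine ⟨fun x hx y hy => ?_, hf.locConst.map₂ hg.locConst (· - ·)⟩
  simp only [Pi.sub_apply, hf.map_mul x hx y hy, hg.map_mul x hx y hy]
  abel

theorem map {D : Type*} [AddCommGroup D] (hf : IsCharOn L f) (c : C →+ D) :
    IsCharOn L (fun x => c (f x)) :=
  ⟨fun x hx y hy => by rw [hf.map_mul x hx y hy, _root_.map_add], hf.locConst.map c⟩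

theorem conj [IsTopologicalGroup F] (hf : IsCharOn L f) {t : F}
    (ht : ∀ l ∈ L, t * l * t⁻¹ ∈ L) : IsCharOn L (fun x => f (t * x * t⁻¹)) := by
  refine ⟨fun x hx y hy => ?_, hf.locConst.comp (c := fun x => t * x * t⁻¹) (by fun_prop) ht⟩
  rw [← hf.map_mul _ (ht x hx) _ (ht y hy)]
  congr 1
  group

/-- The homomorphism on `L` given by a character. -/
def toHom (hf : IsCharOn L f) : L →* Multiplicative C where
  toFun x := Multiplicative.ofAdd (f x)
  map_one' := by simp [hf.map_one]
  map_mul' x y := by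
    rw [← ofAdd_add, ← hf.map_mul x x.2 y y.2, Subgroup.coe_mul]

theorem isLocallyConstant_toHom (hf : IsCharOn L f) : IsLocallyConstant hf.toHom :=
  (locConstOn_iff.1 hf.locConst).comp Multiplicative.ofAdd

end IsCharOn

theorem exists_isCharOn_of_hom {C : Type*} [AddCommGroup C] {L : Subgroup F}
    (φ : L →* Multiplicative C) (hφ : IsLocallyConstant φ) :
    ∃ f : F → C, IsCharOn L f ∧ ∀ x : L, f x = (φ x).toAdd := by
  classical
  have key : ∀ x : L, (fun x : F => if h : x ∈ L then (φ ⟨x, h⟩).toAdd else 0) x =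
      (φ x).toAdd := fun x => by simp
  refine ⟨fun x => if h : x ∈ L then (φ ⟨x, h⟩).toAdd else 0, ⟨fun x hx y hy => ?_, ?_⟩, key⟩
  · simp only [hx, hy, L.mul_mem hx hy, dif_pos]
    rw [← toAdd_mul, ← φ.map_mul]
    rfl
  · rw [locConstOn_iff]
    have h := hφ.comp Multiplicative.toAdd
    rwa [show (Multiplicative.toAdd ∘ φ) = _ from (funext key).symm] at h

theorem isLocallyConstant_of_isOpen_ker [IsTopologicalGroup F] {B : Type*} [Group B] {f : F →* B}
    (hf : (f.ker : Set F) ∈ 𝓝 1) : IsLocallyConstant f := by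
  rw [IsLocallyConstant.iff_eventually_eq]
  intro x
  have hc : Tendsto (fun y => y * x⁻¹) (𝓝 x) (𝓝 1) := by
    have : Continuous fun y : F => y * x⁻¹ := by fun_prop
    simpa using this.tendsto x
  filter_upwards [hc hf] with y hy
  have hy' : f (y * x⁻¹) = 1 := hy
  rwa [map_mul, map_inv, mul_inv_eq_one] at hy'

end Characters

/-! ### Extending characters to subgroups of `p`-power index -/

section Wreath

variable {D Q : Type*} [CommGroup D] [Group Q]

/-- The homomorphism `D ≀ᵣ Q → D × Q` multiplying the coordinates of the base group. -/
def wreathProdHom (D Q : Type*) [CommGroup D] [Group Q] [Fintype Q] : D ≀ᵣ Q →* D × Q where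
  toFun w := (∏ q, w.left q, w.right)
  map_one' := by simp
  map_mul' a b := by
    ext
    · simp only [RegularWreathProduct.mul_left, Pi.mul_apply, Finset.prod_mul_distrib,
        Prod.fst_mul]
      congr 1
      exact Equiv.prod_comp (Equiv.mulLeft a.right⁻¹) b.left
    · simp

theorem wreathProdHom_surjective [Fintype Q] : Function.Surjective (wreathProdHom D Q) := by
  classical
  rintro ⟨d, q⟩
  refine ⟨⟨Pi.mulSingle 1 d, q⟩, ?_⟩
  simp [wreathProdHom]

theorem RegularWreathProduct.conj_left_one (w m : D ≀ᵣ Q) (hm : m.right = 1) :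
    (w * m * w⁻¹).left 1 = m.left w.right⁻¹ := by
  simp [hm, mul_comm]

end Wreath

section Descent

variable {F : Type u} [Group F] [TopologicalSpace F] [IsTopologicalGroup F]
  {p : ℕ} [hp : Fact p.Prime]

theorem prod_range_pow_inv {M : Type*} [CommMonoid M] {c : Multiplicative (ZMod p)} (hc : c ≠ 1)
    (f : Multiplicative (ZMod p) → M) :
    ∏ i ∈ Finset.range p, f (c ^ i)⁻¹ = ∏ q, f q := by
  have hord : orderOf c = p := by
    refine orderOf_eq_prime ?_ hc
    have := pow_card_eq_one' (x := c)
    simpa using this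
  have hinj : Set.InjOn (fun i => (c ^ i)⁻¹) (Finset.range p : Set ℕ) := by
    intro i hi j hj hij
    have := inv_injective hij
    refine pow_injOn_Iio_orderOf (x := c) ?_ ?_ this <;> simp_all
  refine Finset.prod_nbij (fun i => (c ^ i)⁻¹) (fun _ _ => Finset.mem_univ _) hinj ?_
    (fun _ _ => rfl)
  refine Finset.surjOn_of_injOn_of_card_le _ (fun _ _ => Finset.mem_coe.2 (Finset.mem_univ _))
    hinj ?_
  simp

/-- A normal subgroup of prime index is the kernel of a homomorphism onto `ℤ/p`. -/
theorem exists_hom_of_relIndex_eq {L L₁ : Subgroup F}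
    (hn : ∀ x ∈ L₁, ∀ l ∈ L, x * l * x⁻¹ ∈ L) (hidx : L.relIndex L₁ = p)
    (hopen : (L : Set F) ∈ 𝓝[L₁] 1) :
    ∃ χ : L₁ →* Multiplicative (ZMod p), IsLocallyConstant χ ∧ ∀ x, χ x = 1 ↔ (x : F) ∈ L := by
  have : (L.subgroupOf L₁).Normal := ⟨fun l hl x => hn x x.2 l hl⟩
  have hcard : Nat.card (L₁ ⧸ L.subgroupOf L₁) = p := hidx
  let e : (L₁ ⧸ L.subgroupOf L₁) ≃* Multiplicative (ZMod p) :=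
    mulEquivOfPrimeCardEq (p := p) hcard (by simp)
  have hker : ∀ x, (e.toMonoidHom.comp (QuotientGroup.mk' (L.subgroupOf L₁))) x = 1 ↔
      (x : F) ∈ L := by
    intro x
    simp [Subgroup.mem_subgroupOf]
  refine ⟨e.toMonoidHom.comp (QuotientGroup.mk' _), isLocallyConstant_of_isOpen_ker ?_, hker⟩
  rw [nhdsWithin_eq_map_subtype_coe (show (1 : F) ∈ (L₁ : Set F) from L₁.one_mem)] at hopen
  refine mem_of_superset (mem_map.1 hopen) fun x hx => (hker x).2 hx

/-- If `L₁` has the lifting property, every character of `L₁` modulo `p` restricts on a normal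
subgroup `L` of index `p` to the norm of a character of `L`. The character is found by lifting to
the wreath product of `ℤ/p` with `L₁ ⧸ L`. -/
theorem exists_isCharOn_sum_conj_eq {L L₁ : Subgroup F} (hL : L ≤ L₁)
    (hn : ∀ x ∈ L₁, ∀ l ∈ L, x * l * x⁻¹ ∈ L) (hidx : L.relIndex L₁ = p)
    (hopen : (L : Set F) ∈ 𝓝[L₁] 1) (hlift : HasPLifting p L₁) {t : F} (ht : t ∈ L₁)
    (htL : t ∉ L) {φ : F → ZMod p} (hφ : IsCharOn L₁ φ) :
    ∃ ψ : F → ZMod p, IsCharOn L ψ ∧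
      ∀ l ∈ L, ∑ i ∈ Finset.range p, ψ (t ^ i * l * (t ^ i)⁻¹) = φ l := by
  obtain ⟨χ, hχ, hker⟩ := exists_hom_of_relIndex_eq hn hidx hopen
  let C := Multiplicative (ZMod p)
  have hE : IsPGroup p (C ≀ᵣ C) := by
    refine IsPGroup.of_card (n := p + 1) ?_
    rw [RegularWreathProduct.card]
    simp [C, pow_succ]
  have hloc : IsLocallyConstant (hφ.toHom.prod χ) := hφ.isLocallyConstant_toHom.prodMk hχ
  obtain ⟨Θ, hΘ, hΘ'⟩ := hlift (C ≀ᵣ C) (C × C) hE (wreathProdHom C C) wreathProdHom_surjective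
    (hφ.toHom.prod χ) hloc
  have hright : ∀ x, (Θ x).right = χ x := fun x => congrArg Prod.snd (hΘ' x)
  have hleft : ∀ x, ∏ q, (Θ x).left q = hφ.toHom x := fun x => congrArg Prod.fst (hΘ' x)
  have hr1 : ∀ x : L₁, (x : F) ∈ L → (Θ x).right = 1 := fun x hx => by
    rw [hright, (hker x).2 hx]
  let ψ₀ : L →* C :=
    { toFun := fun l => (Θ (Subgroup.inclusion hL l)).left 1
      map_one' := by simp
      map_mul' := fun a b => by
        simp [hr1 (Subgroup.inclusion hL a) a.2] }
  have hψ₀ : IsLocallyConstant ψ₀ :=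
    (hΘ.comp_continuous (continuous_inclusion hL)).comp fun w => w.left 1
  obtain ⟨ψ, hψ, hψ'⟩ := exists_isCharOn_of_hom ψ₀ hψ₀
  refine ⟨ψ, hψ, fun l hl => ?_⟩
  have hterm : ∀ i : ℕ, ψ (t ^ i * l * (t ^ i)⁻¹) =
      ((Θ ⟨l, hL hl⟩).left (χ ⟨t, ht⟩ ^ i)⁻¹).toAdd := by
    intro i
    have hmem : t ^ i * l * (t ^ i)⁻¹ ∈ L := hn _ (L₁.pow_mem ht i) l hl
    rw [hψ' ⟨_, hmem⟩]
    have : Subgroup.inclusion hL ⟨_, hmem⟩ =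
        (⟨t, ht⟩ : L₁) ^ i * ⟨l, hL hl⟩ * ((⟨t, ht⟩ : L₁) ^ i)⁻¹ := rfl
    change ((Θ (Subgroup.inclusion hL ⟨_, hmem⟩)).left 1).toAdd = _
    rw [this, map_mul, map_mul, map_inv,
      RegularWreathProduct.conj_left_one _ _ (hr1 _ hl), hright, map_pow]
  have hχt : χ ⟨t, ht⟩ ≠ 1 := fun h => htL ((hker _).1 h)
  have := prod_range_pow_inv hχt (fun q => (Θ ⟨l, hL hl⟩).left q)
  rw [hleft] at this
  rw [Finset.sum_congr rfl fun i _ => hterm i, ← toAdd_prod, this]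
  rfl

/-- Conjugation by `t`, as an operator on functions. -/
def conjOp (p : ℕ) (t : F) : Module.End (ZMod p) (F → ZMod p) :=
  LinearMap.funLeft (ZMod p) (ZMod p) fun x => t * x * t⁻¹

omit [TopologicalSpace F] [IsTopologicalGroup F] hp in
theorem conjOp_apply (t : F) (f : F → ZMod p) (x : F) : conjOp p t f x = f (t * x * t⁻¹) := rfl

omit [TopologicalSpace F] [IsTopologicalGroup F] hp in
theorem conjOp_pow_apply (t : F) (i : ℕ) (f : F → ZMod p) (x : F) :
    (conjOp p t ^ i) f x = f (t ^ i * x * (t ^ i)⁻¹) := by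
  induction i generalizing x with
  | zero => simp
  | succ i ih =>
    rw [pow_succ', Module.End.mul_apply, conjOp_apply, ih]
    congr 1
    rw [pow_succ]
    group

/-- In characteristic `p` the norm `1 + X + ⋯ + X ^ (p - 1)` equals `(X - 1) ^ (p - 1)`. -/
theorem sub_one_pow_pred_eq_sum {V : Type*} [AddCommGroup V] [Module (ZMod p) V]
    (T : Module.End (ZMod p) V) : (T - 1) ^ (p - 1) = ∑ i ∈ Finset.range p, T ^ i := by
  have h : (Polynomial.X - 1 : Polynomial (ZMod p)) ^ (p - 1) =
      ∑ i ∈ Finset.range p, Polynomial.X ^ i := by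
    have hne : (Polynomial.X - 1 : Polynomial (ZMod p)) ≠ 0 := by
      simpa using Polynomial.X_sub_C_ne_zero (1 : ZMod p)
    refine mul_right_cancel₀ hne ?_
    rw [geom_sum_mul, pow_sub_one_mul hp.out.ne_zero, sub_pow_char, one_pow]
  simpa using congrArg (Polynomial.aeval T) h

theorem sub_one_pow_char {V : Type*} [AddCommGroup V] [Module (ZMod p) V]
    (T : Module.End (ZMod p) V) : (T - 1) ^ p = T ^ p - 1 := by
  have h : (Polynomial.X - 1 : Polynomial (ZMod p)) ^ p = Polynomial.X ^ p - 1 := by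
    rw [sub_pow_char, one_pow]
  simpa using congrArg (Polynomial.aeval T) h

omit [TopologicalSpace F] [IsTopologicalGroup F] in
theorem exists_eq_pow_mul_of_relIndex_eq {L L₁ : Subgroup F}
    (hn : ∀ x ∈ L₁, ∀ l ∈ L, x * l * x⁻¹ ∈ L) (hidx : L.relIndex L₁ = p)
    {t : F} (ht : t ∈ L₁) (htL : t ∉ L) {x : F} (hx : x ∈ L₁) :
    ∃ i : ℕ, ∃ l ∈ L, x = t ^ i * l := by
  have : (L.subgroupOf L₁).Normal := ⟨fun l hl x => hn x x.2 l hl⟩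
  have hcard : Nat.card (L₁ ⧸ L.subgroupOf L₁) = p := hidx
  have hne : (QuotientGroup.mk (⟨t, ht⟩ : L₁) : L₁ ⧸ L.subgroupOf L₁) ≠ 1 := by
    rw [Ne, QuotientGroup.eq_one_iff]
    exact htL
  obtain ⟨i, hi⟩ := mem_powers_of_prime_card (g' := (QuotientGroup.mk (⟨x, hx⟩ : L₁))) hcard hne
  have hi' : (QuotientGroup.mk ((⟨t, ht⟩ : L₁) ^ i) : L₁ ⧸ L.subgroupOf L₁) =
    QuotientGroup.mk ⟨x, hx⟩ := hi
  rw [QuotientGroup.eq] at hi'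
  refine ⟨i, (t ^ i)⁻¹ * x, hi', by group⟩

/-- The property of extending functions modulo `p` to characters descends to normal subgroups of
index `p`: with `T` the conjugation by an element `t` of `L₁` outside `L`, a function `h` with
`(T - 1) ^ (k + 1) h = 0` is corrected by a character `ψ` of `L` with
`(T - 1) ^ k h = (T - 1) ^ k ψ`. -/
theorem CharExtends.of_relIndex_eq_prime {A : Set F} {L L₁ : Subgroup F} (hL : L ≤ L₁)
    (hn : ∀ x ∈ L₁, ∀ l ∈ L, x * l * x⁻¹ ∈ L) (hidx : L.relIndex L₁ = p)
    (hopen : (L : Set F) ∈ 𝓝[L₁] 1) (hlift : HasPLifting p L₁)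
    (hAL : A ⊆ L) (hA : ∀ x ∈ L₁, ∀ a ∈ A, x * a * x⁻¹ ∈ A)
    (hext : CharExtends A L₁ p) : CharExtends A L p := by
  obtain ⟨t, ht, htL⟩ : ∃ t ∈ L₁, t ∉ L := by
    by_contra! hcon
    rw [Subgroup.relIndex_eq_one.2 hcon] at hidx
    exact hp.out.one_lt.ne hidx
  set T := conjOp p t with hT
  have hTchar : ∀ (k : ℕ) (f : F → ZMod p), IsCharOn L f → IsCharOn L (((T - 1) ^ k) f) := by
    intro k
    induction k with
    | zero => simp
    | succ k ih =>
      intro f hf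
      rw [pow_succ', Module.End.mul_apply, LinearMap.sub_apply]
      exact ((ih f hf).conj (hn t ht)).sub (ih f hf)
  have hTinv : ∀ (k : ℕ) (f : F → ZMod p),
      (LocConstOn A f ∧ ∀ l ∈ L, ∀ a ∈ A, f (l * a * l⁻¹) = f a) →
      LocConstOn A (((T - 1) ^ k) f) ∧
        ∀ l ∈ L, ∀ a ∈ A, ((T - 1) ^ k) f (l * a * l⁻¹) = ((T - 1) ^ k) f a := by
    intro k
    induction k with
    | zero => intro f hf; simpa using hf
    | succ k ih =>
      intro f hf
      obtain ⟨h1, h2⟩ := ih f hf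
      rw [pow_succ', Module.End.mul_apply, LinearMap.sub_apply]
      generalize ((T - 1) ^ k) f = g at h1 h2 ⊢
      refine ⟨?_, fun l hl a ha => ?_⟩
      · exact (h1.comp (c := fun x => t * x * t⁻¹) (by fun_prop) (hA t ht)).map₂ h1 (· - ·)
      · have hconj : g (t * (l * a * l⁻¹) * t⁻¹) = g (t * a * t⁻¹) := by
          rw [← h2 (t * l * t⁻¹) (hn t ht l hl) (t * a * t⁻¹) (hA t ht a ha)]
          congr 1
          group
        change g (t * (l * a * l⁻¹) * t⁻¹) - g (l * a * l⁻¹) = g (t * a * t⁻¹) - g a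
        rw [hconj, h2 l hl a ha]
  have key : ∀ k ≤ p, ∀ h : F → ZMod p, LocConstOn A h →
      (∀ l ∈ L, ∀ a ∈ A, h (l * a * l⁻¹) = h a) → (∀ a ∈ A, ((T - 1) ^ k) h a = 0) →
      ∃ φ : F → ZMod p, IsCharOn L φ ∧ ∀ a ∈ A, φ a = h a := by
    intro k
    induction k with
    | zero =>
      intro _ h hloc hinv hk
      refine ⟨0, ⟨by simp, fun x _ => by simp⟩, fun a ha => ?_⟩
      simpa using (hk a ha).symm
    | succ k ih =>
      intro hkp h hloc hinv hk
      obtain ⟨hg1, hg2⟩ := hTinv k h ⟨hloc, hinv⟩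
      set g := ((T - 1) ^ k) h with hg
      have hgt : ∀ a ∈ A, g (t * a * t⁻¹) = g a := by
        intro a ha
        have := hk a ha
        rw [pow_succ', Module.End.mul_apply, ← hg] at this
        exact sub_eq_zero.1 this
      have hgpow : ∀ i : ℕ, ∀ a ∈ A, g (t ^ i * a * (t ^ i)⁻¹) = g a := by
        intro i
        induction i with
        | zero => simp
        | succ i ihi =>
          intro a ha
          rw [← ihi a ha, ← hgt _ (hA _ (L₁.pow_mem ht i) a ha), pow_succ']
          congr 1
          group
      obtain ⟨φ, hφ, hφA⟩ := hext g hg1 fun x hx a ha => by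
        obtain ⟨i, l, hl, rfl⟩ := exists_eq_pow_mul_of_relIndex_eq hn hidx ht htL hx
        rw [← hg2 l hl a ha, ← hgpow i _ (hA l (hL hl) a ha)]
        congr 1
        group
      obtain ⟨ψ, hψ, hψL⟩ := exists_isCharOn_sum_conj_eq hL hn hidx hopen hlift ht htL hφ
      have hψ' := hTchar (p - 1 - k) ψ hψ
      set ψ' := ((T - 1) ^ (p - 1 - k)) ψ with hψ'_def
      have hkill : ∀ a ∈ A, ((T - 1) ^ k) (h - ψ') a = 0 := by
        intro a ha
        rw [map_sub, ← hg, hψ'_def, ← Module.End.mul_apply, ← pow_add,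
          show k + (p - 1 - k) = p - 1 by omega, sub_one_pow_pred_eq_sum, Pi.sub_apply,
          LinearMap.sum_apply, Finset.sum_apply]
        simp only [hT, conjOp_pow_apply]
        rw [hψL a (hAL ha), hφA a ha, sub_self]
      obtain ⟨φ', hφ', hφ'A⟩ := ih (by omega) (h - ψ')
        (hloc.map₂ (hψ'.locConst.mono hAL) (· - ·))
        (fun l hl a ha => by
          rw [Pi.sub_apply, Pi.sub_apply, hinv l hl a ha, hψ'.map_conj (hAL ha) hl]) hkill
      exact ⟨φ' + ψ', hφ'.add hψ', fun a ha => by simp [hφ'A a ha]⟩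
  intro h hloc hinv
  refine key p le_rfl h hloc hinv fun a ha => ?_
  -- `T ^ p` is the conjugation by `t ^ p ∈ L`, so that `(T - 1) ^ p` kills `h`
  have htp : t ^ p ∈ L := by
    obtain ⟨χ, -, hker⟩ := exists_hom_of_relIndex_eq hn hidx hopen
    refine (hker (⟨t, ht⟩ ^ p)).1 ?_
    rw [map_pow]
    simpa using pow_card_eq_one' (x := χ ⟨t, ht⟩)
  rw [sub_one_pow_char, LinearMap.sub_apply, Pi.sub_apply, hT, conjOp_pow_apply, hinv _ htp a ha]
  simp

/-- The property of extending functions modulo `p` to characters descends to normal subgroups of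
`p`-power index. -/
theorem CharExtends.of_relIndex_eq_prime_pow {A : Set F} {L : Subgroup F} (hAL : A ⊆ L) (m : ℕ) :
    ∀ R : Subgroup F, L ≤ R → (∀ x ∈ R, ∀ l ∈ L, x * l * x⁻¹ ∈ L) → L.relIndex R = p ^ m →
      (L : Set F) ∈ 𝓝[R] 1 → (∀ M : Subgroup F, L ≤ M → M ≤ R → HasPLifting p M) →
      (∀ x ∈ R, ∀ a ∈ A, x * a * x⁻¹ ∈ A) → CharExtends A R p → CharExtends A L p := by
  induction m with
  | zero =>
    intro R hLR _ hidx _ _ _ hext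
    rw [pow_zero, Subgroup.relIndex_eq_one] at hidx
    rwa [le_antisymm hLR hidx]
  | succ m ih =>
    intro R hLR hn hidx hopen hlift hA hext
    have hN : (L.subgroupOf R).Normal := ⟨fun l hl x => hn x x.2 l hl⟩
    have hcard : Nat.card (R ⧸ L.subgroupOf R) = p ^ (m + 1) := hidx
    have hfin : Finite (R ⧸ L.subgroupOf R) :=
      Nat.finite_of_card_ne_zero (by rw [hcard]; exact pow_ne_zero _ hp.out.ne_zero)
    obtain ⟨H, hH⟩ := Sylow.exists_subgroup_card_pow_prime (G := R ⧸ L.subgroupOf R) p (n := m)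
      (by rw [hcard]; exact pow_dvd_pow p m.le_succ)
    have hHidx : H.index = p := by
      have := H.card_mul_index
      rw [hcard, hH, pow_succ] at this
      exact Nat.eq_of_mul_eq_mul_left (pow_pos hp.out.pos m) this
    have hHn : H.Normal := by
      refine Subgroup.normal_of_index_eq_minFac_card ?_
      rw [hHidx, hcard, hp.out.pow_minFac m.succ_ne_zero]
    set R₁' := H.comap (QuotientGroup.mk' (L.subgroupOf R))
    set R₁ := R₁'.map R.subtype
    have hsub : R₁.subgroupOf R = R₁' :=
      Subgroup.comap_map_eq_self_of_injective R.subtype_injective R₁'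
    have hR₁R : R₁ ≤ R := Subgroup.map_subtype_le R₁'
    have hLR₁ : L ≤ R₁ := by
      intro l hl
      refine ⟨⟨l, hLR hl⟩, ?_, rfl⟩
      have : (QuotientGroup.mk' (L.subgroupOf R)) ⟨l, hLR hl⟩ = 1 :=
        (QuotientGroup.eq_one_iff _).2 hl
      change QuotientGroup.mk' (L.subgroupOf R) ⟨l, hLR hl⟩ ∈ H
      rw [this]
      exact H.one_mem
    have hidx₁ : R₁.relIndex R = p := by
      rw [Subgroup.relIndex, hsub,
        Subgroup.index_comap_of_surjective _ (QuotientGroup.mk'_surjective _), hHidx]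
    have hn₁ : ∀ x ∈ R, ∀ l ∈ R₁, x * l * x⁻¹ ∈ R₁ := by
      rintro x hx _ ⟨l, hl, rfl⟩
      have : R₁'.Normal := hHn.comap _
      exact ⟨⟨x, hx⟩ * l * ⟨x, hx⟩⁻¹, this.conj_mem l hl ⟨x, hx⟩, rfl⟩
    have hidx₂ : L.relIndex R₁ = p ^ m := by
      have := Subgroup.relIndex_mul_relIndex L R₁ R hLR₁ hR₁R
      rw [hidx, hidx₁, pow_succ] at this
      exact Nat.eq_of_mul_eq_mul_right hp.out.pos this
    have hext₁ : CharExtends A R₁ p :=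
      CharExtends.of_relIndex_eq_prime hR₁R hn₁ hidx₁ (mem_of_superset hopen hLR₁)
        (hlift R hLR le_rfl) (hAL.trans hLR₁) hA hext
    exact ih R₁ hLR₁ (fun x hx => hn x (hR₁R hx)) hidx₂ (nhdsWithin_mono 1 hR₁R hopen)
      (fun M hLM hMR => hlift M hLM (hMR.trans hR₁R)) (fun x hx => hA x (hR₁R hx)) hext₁

theorem ZMod.exists_eq_mul_of_castHom_eq_zero {k : ℕ} (hk : p ∣ p ^ k) {x : ZMod (p ^ k)}
    (hx : ZMod.castHom hk (ZMod p) x = 0) : ∃ c, x = p * c := by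
  have : NeZero (p ^ k) := ⟨pow_ne_zero _ hp.out.ne_zero⟩
  rw [← ZMod.natCast_zmod_val x, map_natCast, ZMod.natCast_eq_zero_iff] at hx
  obtain ⟨c, hc⟩ := hx
  exact ⟨c, by rw [← ZMod.natCast_zmod_val x, hc]; push_cast; ring⟩

omit [IsTopologicalGroup F] in
theorem HasPLifting.exists_isCharOn {L : Subgroup F} (hlift : HasPLifting p L) {k m : ℕ}
    (hm : m ∣ p ^ k) {φ : F → ZMod m} (hφ : IsCharOn L φ) :
    ∃ ψ : F → ZMod (p ^ k), IsCharOn L ψ ∧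
      ∀ x ∈ L, ZMod.castHom hm (ZMod m) (ψ x) = φ x := by
  have : NeZero (p ^ k) := ⟨pow_ne_zero _ hp.out.ne_zero⟩
  have hE : IsPGroup p (Multiplicative (ZMod (p ^ k))) :=
    IsPGroup.of_card (n := k) (by simp)
  obtain ⟨ψ₀, hψ₀, hψ₀'⟩ := hlift (Multiplicative (ZMod (p ^ k))) (Multiplicative (ZMod m))
    hE (AddMonoidHom.toMultiplicative (ZMod.castHom hm (ZMod m)).toAddMonoidHom)
    (fun y => by
      obtain ⟨x, hx⟩ := ZMod.castHom_surjective hm y.toAdd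
      exact ⟨Multiplicative.ofAdd x, by simp [hx]⟩) hφ.toHom hφ.isLocallyConstant_toHom
  obtain ⟨ψ, hψ, hψ'⟩ := exists_isCharOn_of_hom ψ₀ hψ₀
  refine ⟨ψ, hψ, fun x hx => ?_⟩
  rw [hψ' ⟨x, hx⟩]
  exact congrArg Multiplicative.toAdd (hψ₀' ⟨x, hx⟩)

omit [IsTopologicalGroup F] in
theorem CharExtends.prime_pow {A : Set F} {L : Subgroup F} (hlift : HasPLifting p L)
    (hAL : A ⊆ L) (hext : CharExtends A L p) (k : ℕ) : CharExtends A L (p ^ k) := by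
  have key : ∀ i ≤ k, ∀ h : F → ZMod (p ^ k), LocConstOn A h →
      (∀ l ∈ L, ∀ a ∈ A, h (l * a * l⁻¹) = h a) → (∀ a ∈ A, ∃ c, h a = p ^ (k - i) * c) →
      ∃ φ : F → ZMod (p ^ k), IsCharOn L φ ∧ ∀ a ∈ A, φ a = h a := by
    intro i
    induction i with
    | zero =>
      intro _ h hloc hinv hk
      refine ⟨0, ⟨by simp, fun x _ => by simp⟩, fun a ha => ?_⟩
      obtain ⟨c, hc⟩ := hk a ha
      have h0 : (p : ZMod (p ^ k)) ^ k = 0 := by exact_mod_cast ZMod.natCast_self (p ^ k)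
      rw [hc, Nat.sub_zero, h0, zero_mul, Pi.zero_apply]
    | succ i ih =>
      intro hik h hloc hinv hk
      classical
      set j := k - (i + 1) with hj
      have hdvd : p ∣ p ^ k := dvd_pow_self p (by omega)
      -- a division by `p ^ j` on the multiples of `p ^ j`
      let s : ZMod (p ^ k) → ZMod (p ^ k) := fun y =>
        if hy : ∃ c, y = p ^ j * c then hy.choose else 0
      have hs : ∀ a ∈ A, h a = p ^ j * s (h a) := fun a ha => by
        simp only [s, dif_pos (hk a ha)]
        exact (hk a ha).choose_spec
      obtain ⟨ψ, hψ, hψA⟩ := hext (fun x => ZMod.castHom hdvd (ZMod p) (s (h x)))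
        (hloc.map fun y => ZMod.castHom hdvd (ZMod p) (s y))
        (fun l hl a ha => by rw [hinv l hl a ha])
      obtain ⟨ψ', hψ', hψ'L⟩ : ∃ ψ' : F → ZMod (p ^ k), IsCharOn L ψ' ∧
          ∀ x ∈ L, ZMod.castHom hdvd (ZMod p) (ψ' x) = ψ x := hlift.exists_isCharOn hdvd hψ
      have hmul : IsCharOn L fun x => (p : ZMod (p ^ k)) ^ j * ψ' x :=
        hψ'.map (AddMonoidHom.mulLeft _)
      obtain ⟨φ, hφ, hφA⟩ := ih (by omega) (fun x => h x - p ^ j * ψ' x)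
        (hloc.map₂ (hmul.locConst.mono hAL) (· - ·))
        (fun l hl a ha => by rw [hinv l hl a ha, hψ'.map_conj (hAL ha) hl])
        (fun a ha => by
          obtain ⟨c, hc⟩ := ZMod.exists_eq_mul_of_castHom_eq_zero hdvd
            (x := s (h a) - ψ' a) (by rw [map_sub, hψ'L a (hAL ha), hψA a ha, sub_self])
          refine ⟨c, ?_⟩
          have hpow : k - i = j + 1 := by omega
          rw [hpow, pow_succ, mul_assoc, ← hc, mul_sub, ← hs a ha])
      refine ⟨_, hφ.add hmul, fun a ha => ?_⟩
      simp [hφA a ha]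
  intro h hloc hinv
  exact key k le_rfl h hloc hinv fun a _ => ⟨h a, by simp⟩

end Descent

/-! ### Characters and torsion -/

section Torsion

variable {F : Type u} [Group F] [TopologicalSpace F] {p : ℕ}

theorem IsCharOn.isClosed_eq {C : Type*} [AddCommGroup C] {R : Subgroup F}
    (hR : IsClosed (R : Set F)) {f g : F → C} (hf : IsCharOn R f) (hg : IsCharOn R g) :
    IsClosed {x | x ∈ R ∧ f x = g x} := by
  have h : IsLocallyConstant fun x : R => f x - g x :=
    locConstOn_iff.1 (hf.locConst.map₂ hg.locConst (· - ·))
  have := hR.isClosedEmbedding_subtypeVal.isClosedMap _ (h.isClosed_fiber 0)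
  convert this using 1
  ext x
  simp [sub_eq_zero, and_comm]

/-- Two characters of a closed subgroup agree if they agree on a set of topological generators. -/
theorem IsCharOn.eq_of_eq_on [IsTopologicalGroup F] {C : Type*} [AddCommGroup C] {R : Subgroup F}
    (hR : IsClosed (R : Set F)) {A : Set F} (hAR : A ⊆ R)
    (hgen : R ≤ (Subgroup.closure A).topologicalClosure) {f g : F → C} (hf : IsCharOn R f)
    (hg : IsCharOn R g) (hfg : ∀ a ∈ A, f a = g a) {x : F} (hx : x ∈ R) : f x = g x := by
  let E : Subgroup F :=
    { carrier := {x | x ∈ R ∧ f x = g x}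
      one_mem' := ⟨R.one_mem, by rw [hf.map_one, hg.map_one]⟩
      mul_mem' := fun {a b} ha hb => ⟨R.mul_mem ha.1 hb.1, by
        rw [hf.map_mul _ ha.1 _ hb.1, hg.map_mul _ ha.1 _ hb.1, ha.2, hb.2]⟩
      inv_mem' := fun {a} ha => ⟨R.inv_mem ha.1, by
        rw [hf.map_inv ha.1, hg.map_inv ha.1, ha.2]⟩ }
  have hE : (Subgroup.closure A).topologicalClosure ≤ E :=
    Subgroup.topologicalClosure_minimal _
      ((Subgroup.closure_le _).2 fun a ha => ⟨hAR ha, hfg a ha⟩) (hf.isClosed_eq hR hg)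
  exact (hE (hgen hx)).2

/-- Every `N`-invariant character `R → ℤ/p^k` lifts to an `N`-invariant character
`R → ℤ/p^(k+1)`. -/
def CharsLift (p : ℕ) (R N : Subgroup F) : Prop :=
  ∀ (k : ℕ) (θ : F → ZMod (p ^ k)), IsCharOn R θ → (∀ n ∈ N, ∀ x ∈ R, θ (n * x * n⁻¹) = θ x) →
    ∃ θ' : F → ZMod (p ^ (k + 1)), IsCharOn R θ' ∧
      (∀ n ∈ N, ∀ x ∈ R, θ' (n * x * n⁻¹) = θ' x) ∧
      ∀ x ∈ R, ZMod.castHom (pow_dvd_pow p k.le_succ) (ZMod (p ^ k)) (θ' x) = θ x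

/-- The elements of order `p` of `R / K` are separated from `1` by characters `R → ℤ/p^k` that
vanish on `K`. -/
def CharsSeparate (p : ℕ) (R K : Subgroup F) : Prop :=
  ∀ x ∈ R, x ∉ K → x ^ p ∈ K → ∃ (k : ℕ) (θ : F → ZMod (p ^ k)), IsCharOn R θ ∧
    (∀ y ∈ K, θ y = 0) ∧ θ x ≠ 0

theorem ZMod.castHom_eq_zero_of_mul_eq_zero [hp : Fact p.Prime] {k : ℕ} {x : ZMod (p ^ (k + 1))}
    (hx : (p : ZMod (p ^ (k + 1))) * x = 0) :
    ZMod.castHom (pow_dvd_pow p k.le_succ) (ZMod (p ^ k)) x = 0 := by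
  have : NeZero (p ^ (k + 1)) := ⟨pow_ne_zero _ hp.out.ne_zero⟩
  rw [← ZMod.natCast_zmod_val x] at hx ⊢
  rw [← Nat.cast_mul, ZMod.natCast_eq_zero_iff] at hx
  rw [map_natCast, ZMod.natCast_eq_zero_iff]
  refine (Nat.mul_dvd_mul_iff_left hp.out.pos).1 ?_
  rwa [← pow_succ']

/-- If the `N`-invariant characters of `R` lift and separate the elements of order `p` of
`R / [R, N]`, there are none of them: `p θ'(x) = 0` forces `θ(x) = 0` for a lift `θ'` of `θ`. -/
theorem mem_of_pow_mem_of_charsLift [IsTopologicalGroup F] [Fact p.Prime] {R N : Subgroup F}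
    [hRn : R.Normal] (hR : IsClosed (R : Set F)) (hlift : CharsLift p R N)
    (hsep : CharsSeparate p R ⁅R, N⁆.topologicalClosure) {x : F} (hx : x ∈ R)
    (hxp : x ^ p ∈ ⁅R, N⁆.topologicalClosure) : x ∈ ⁅R, N⁆.topologicalClosure := by
  by_contra hxK
  obtain ⟨k, θ, hθ, hθK, hθx⟩ := hsep x hx hxK hxp
  have hKR : ⁅R, N⁆ ≤ R := Subgroup.commutator_le_left R N
  obtain ⟨θ', hθ', hinv, hred⟩ := hlift k θ hθ fun n hn y hy => by
    have hc : n * y * n⁻¹ * y⁻¹ ∈ ⁅R, N⁆ := by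
      rw [Subgroup.commutator_comm]
      exact Subgroup.commutator_mem_commutator hn hy
    have := hθ.map_mul _ (hKR hc) _ hy
    rwa [inv_mul_cancel_right, hθK _ (Subgroup.le_topologicalClosure _ hc), zero_add] at this
  have hzero : IsCharOn R (0 : F → ZMod (p ^ (k + 1))) := ⟨by simp, fun x _ => by simp⟩
  let E : Subgroup F :=
    { carrier := {x | x ∈ R ∧ θ' x = (0 : F → ZMod (p ^ (k + 1))) x}
      one_mem' := ⟨R.one_mem, hθ'.map_one⟩
      mul_mem' := fun {a b} ha hb => ⟨R.mul_mem ha.1 hb.1, by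
        rw [hθ'.map_mul _ ha.1 _ hb.1, ha.2, hb.2]; simp⟩
      inv_mem' := fun {a} ha => ⟨R.inv_mem ha.1, by rw [hθ'.map_inv ha.1, ha.2]; simp⟩ }
  have hE : ⁅R, N⁆.topologicalClosure ≤ E := by
    refine Subgroup.topologicalClosure_minimal _ ?_ (hθ'.isClosed_eq hR hzero)
    rw [Subgroup.commutator_le]
    intro r hr n hn
    refine ⟨hKR (Subgroup.commutator_mem_commutator hr hn), ?_⟩
    change θ' (r * n * r⁻¹ * n⁻¹) = 0
    rw [show r * n * r⁻¹ * n⁻¹ = r * (n * r⁻¹ * n⁻¹) by group,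
      hθ'.map_mul _ hr _ (hRn.conj_mem _ (R.inv_mem hr) n), hinv n hn _ (R.inv_mem hr),
      hθ'.map_inv hr]
    simp
  have h0 : θ' (x ^ p) = 0 := (hE hxp).2
  rw [hθ'.map_pow hx, nsmul_eq_mul] at h0
  exact hθx (by rw [← hred x hx, ZMod.castHom_eq_zero_of_mul_eq_zero h0])

/-- Characters of `R` lift if invariant functions on a generating set `A` of `R` extend to
characters of larger subgroups: lift the values on `A`. -/
theorem charsLift_of_charExtends [IsTopologicalGroup F] {R N : Subgroup F} [hRn : R.Normal]
    (hR : IsClosed (R : Set F)) {A : Set F} (hAR : A ⊆ R)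
    (hgen : R ≤ (Subgroup.closure A).topologicalClosure)
    (hA : ∀ x : F, ∀ a ∈ A, x * a * x⁻¹ ∈ A)
    (hext : ∀ (k : ℕ) (θ : F → ZMod (p ^ k)), IsCharOn R θ →
      (∀ n ∈ N, ∀ x ∈ R, θ (n * x * n⁻¹) = θ x) → ∃ L : Subgroup F, R ≤ L ∧
        CharExtends A L (p ^ (k + 1)) ∧ ∀ l ∈ L, ∀ x ∈ R, θ (l * x * l⁻¹) = θ x) :
    CharsLift p R N := by
  intro k θ hθ hinv
  obtain ⟨L, hRL, hL, hLinv⟩ := hext k θ hθ hinv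
  have hsurj := ZMod.castHom_surjective (pow_dvd_pow p k.le_succ)
  obtain ⟨φ, hφ, hφA⟩ := hL (fun x => Function.surjInv hsurj (θ x))
    ((hθ.locConst.mono hAR).map _) fun l hl a ha => by rw [hLinv l hl a (hAR ha)]
  have hφR := hφ.mono hRL
  refine ⟨φ, hφR, fun n hn x hx => ?_, fun x hx => ?_⟩
  · refine IsCharOn.eq_of_eq_on hR hAR hgen (hφR.conj fun l hl => hRn.conj_mem l hl n) hφR
      (fun a ha => ?_) hx
    rw [hφA _ (hA n a ha), hφA a ha, hinv n hn a (hAR ha)]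
  · refine IsCharOn.eq_of_eq_on hR hAR hgen (hφR.map
      (ZMod.castHom (pow_dvd_pow p k.le_succ) (ZMod (p ^ k))).toAddMonoidHom) hθ
      (fun a ha => ?_) hx
    rw [hφA a ha]
    exact Function.surjInv_eq hsurj (θ a)

end Torsion

/-! ### Separating torsion elements by characters -/

section Separation

open DirectSum in
/-- In a finitely generated abelian group, a nonzero element of `p`-power order is detected by a
homomorphism to a cyclic group of `p`-power order. -/
theorem exists_addMonoidHom_zmod_ne_zero {A : Type*} [AddCommGroup A] [AddGroup.FG A] {p : ℕ}
    (hp : p.Prime) {x : A} (hx : x ≠ 0) {m : ℕ} (hm : p ^ m • x = 0) :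
    ∃ (k : ℕ) (f : A →+ ZMod (p ^ k)), f x ≠ 0 := by
  classical
  obtain ⟨n, ι, _, q, hq, e, ⟨Φ⟩⟩ := AddCommGroup.equiv_free_prod_directSum_zmod A
  have hΦx : Φ x ≠ 0 := fun h => hx (by simpa using h)
  have hΦm : p ^ m • Φ x = 0 := by rw [← map_nsmul, hm, map_zero]
  have h1 : (Φ x).1 = 0 := by
    have h := congrArg Prod.fst hΦm
    ext i
    have := DFunLike.congr_fun h i
    have hpm : p ^ m ≠ 0 := pow_ne_zero _ hp.ne_zero
    simpa [hpm, hp.ne_zero] using this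
  have h2 : (Φ x).2 ≠ 0 := fun h => hΦx (Prod.ext h1 h)
  obtain ⟨i, hi⟩ : ∃ i, (Φ x).2 i ≠ 0 := by
    by_contra! hcon
    exact h2 (DFinsupp.ext hcon)
  have hmi : p ^ m • (Φ x).2 i = 0 := by
    exact DFunLike.congr_fun (congrArg Prod.snd hΦm) i
  have hqp : q i = p := by
    by_contra hne
    refine hi ?_
    have hcop : Nat.Coprime (p ^ m) (q i ^ e i) :=
      Nat.Coprime.pow _ _ ((Nat.coprime_primes hp (hq i)).2 (Ne.symm hne))
    have hunit : IsUnit ((p ^ m : ℕ) : ZMod (q i ^ e i)) := (ZMod.isUnit_iff_coprime _ _).2 hcop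
    rw [nsmul_eq_mul] at hmi
    exact (hunit.mul_right_eq_zero).1 hmi
  rw [← hqp]
  exact ⟨e i, (DFinsupp.evalAddMonoidHom i).comp ((AddMonoidHom.snd _ _).comp Φ.toAddMonoidHom), hi⟩

variable {F : Type u} [Group F] [TopologicalSpace F] [IsTopologicalGroup F] {p : ℕ}

/-- Elements of `p`-power order of a finitely generated abelian quotient `R / W` of `R` are detected
by characters of `R`. -/
theorem exists_isCharOn_ne_zero [hp : Fact p.Prime] {R W : Subgroup F} [hW : W.Normal]
    (hab : ⁅R, R⁆ ≤ W) (hopen : (W : Set F) ∈ 𝓝[R] 1) (hfg : Group.FG (R ⧸ W.subgroupOf R)) {x : F}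
    (hx : x ∈ R) (hxW : x ∉ W) {m : ℕ} (hm : x ^ p ^ m ∈ W) :
    ∃ (k : ℕ) (θ : F → ZMod (p ^ k)), IsCharOn R θ ∧ (∀ y ∈ R, y ∈ W → θ y = 0) ∧ θ x ≠ 0 := by
  let A := R ⧸ W.subgroupOf R
  let _ : CommGroup A :=
    { (inferInstance : Group A) with
      mul_comm := by
        intro a b
        induction a using QuotientGroup.induction_on with | _ a
        induction b using QuotientGroup.induction_on with | _ b
        refine (QuotientGroup.eq (s := W.subgroupOf R)).2 ?_
        rw [Subgroup.mem_subgroupOf]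
        have := hab (Subgroup.commutator_mem_commutator (R.inv_mem b.2) (R.inv_mem a.2))
        convert this using 1
        simp [commutatorElement_def, mul_assoc] }
  have hfgA : Group.FG A := hfg
  have hne : Additive.ofMul (QuotientGroup.mk (⟨x, hx⟩ : R) : A) ≠ 0 := by
    intro h
    exact hxW ((QuotientGroup.eq_one_iff (N := W.subgroupOf R) _).1 h)
  have htor : p ^ m • Additive.ofMul (QuotientGroup.mk (⟨x, hx⟩ : R) : A) = 0 :=
    (QuotientGroup.eq_one_iff (N := W.subgroupOf R) ((⟨x, hx⟩ : R) ^ p ^ m)).2 hm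
  obtain ⟨k, f, hf⟩ := exists_addMonoidHom_zmod_ne_zero hp.out hne htor
  let g : R →* Multiplicative (ZMod (p ^ k)) :=
    (AddMonoidHom.toMultiplicativeRight f).comp (QuotientGroup.mk' (W.subgroupOf R))
  have hgW : ∀ y : R, (y : F) ∈ W → g y = 1 := fun y hy => by
    have : (QuotientGroup.mk' (W.subgroupOf R)) y = 1 := (QuotientGroup.eq_one_iff _).2 hy
    change (AddMonoidHom.toMultiplicativeRight f) (QuotientGroup.mk' (W.subgroupOf R) y) = 1
    rw [this]
    exact map_one _
  have hg : IsLocallyConstant g := by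
    refine isLocallyConstant_of_isOpen_ker ?_
    rw [nhdsWithin_eq_map_subtype_coe (show (1 : F) ∈ (R : Set F) from R.one_mem)] at hopen
    exact mem_of_superset (mem_map.1 hopen) fun y hy => hgW y hy
  obtain ⟨θ, hθ, hθg⟩ := exists_isCharOn_of_hom g hg
  refine ⟨k, θ, hθ, fun y hy hyW => ?_, ?_⟩
  · rw [hθg ⟨y, hy⟩, hgW ⟨y, hy⟩ hyW]
    rfl
  · rw [hθg ⟨x, hx⟩]
    exact hf

/-- In a pro-`p` group, characters separate points of `R` from a closed normal subgroup `K`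
containing the commutators of `R`. -/
theorem IsProP.charsSeparate [hp : Fact p.Prime] (hF : IsProP p F) {R K : Subgroup F} [K.Normal]
    (hKR : K ≤ R) (hab : ⁅R, R⁆ ≤ K) (hK : IsClosed (K : Set F)) : CharsSeparate p R K := by
  intro x hx hxK _
  have := hF.compact
  have := hF.totallyDisconnected
  have hnhds : {v : F | x * v ∉ K} ∈ 𝓝 1 := by
    refine (hK.isOpen_compl.preimage (continuous_const_mul x)).mem_nhds ?_
    simpa using hxK
  obtain ⟨O, hOsub, hO, h1⟩ := mem_nhds_iff.1 hnhds
  obtain ⟨V, hV⟩ := ProfiniteGrp.exist_openNormalSubgroup_sub_open_nhds_of_one hO h1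
  have hxW : x ∉ K ⊔ V.toSubgroup := by
    intro h
    obtain ⟨k, hk, v, hv, rfl⟩ := Subgroup.mem_sup_of_normal_left.1 h
    refine hOsub (hV (V.toSubgroup.inv_mem hv)) ?_
    simpa using hk
  have hopen : ((K ⊔ V.toSubgroup : Subgroup F) : Set F) ∈ 𝓝 1 :=
    mem_of_superset (V.toOpenSubgroup.isOpen.mem_nhds V.toSubgroup.one_mem)
      (le_sup_right : V.toSubgroup ≤ K ⊔ V.toSubgroup)
  have hWopen : IsOpen ((K ⊔ V.toSubgroup : Subgroup F) : Set F) :=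
    Subgroup.isOpen_of_mem_nhds _ hopen
  have : Finite (F ⧸ (K ⊔ V.toSubgroup)) := Subgroup.quotient_finite_of_isOpen _ hWopen
  have : (K ⊔ V.toSubgroup).FiniteIndex := Subgroup.finiteIndex_of_finite_quotient
  have hfin : Finite (R ⧸ (K ⊔ V.toSubgroup).subgroupOf R) := inferInstance
  obtain ⟨m, hm⟩ := hF.isPGroup_quotient V (QuotientGroup.mk x)
  have hm' : x ^ p ^ m ∈ V.toSubgroup := (QuotientGroup.eq_one_iff _).1 hm
  obtain ⟨k, θ, hθ, hθW, hθx⟩ := exists_isCharOn_ne_zero (hab.trans le_sup_left)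
    (mem_nhdsWithin_of_mem_nhds hopen) inferInstance hx hxW
    ((le_sup_right : V.toSubgroup ≤ K ⊔ V.toSubgroup) hm')
  exact ⟨k, θ, hθ, fun y hy => hθW y (hKR hy) ((le_sup_left : K ≤ K ⊔ V.toSubgroup) hy), hθx⟩

end Separation

/-! ### The lifting property of subgroups of free pro-`p` groups -/

section MonomialRepresentation

variable {F : Type u} [Group F] {U : Subgroup F} {B : Type v} [Group B]

/-- The wreath product `(F ⧸ U → B) ⋊ Perm (F ⧸ U)`. -/
abbrev PermWreath (U : Subgroup F) (B : Type v) [Group B] : Type (max u v) :=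
  (F ⧸ U → B) ⋊[mulAutArrow (G := Equiv.Perm (F ⧸ U)) (A := F ⧸ U) (M := B)] Equiv.Perm (F ⧸ U)

/-- The cocycle `s(f y)⁻¹ f s(y)` of a section `s` of `F → F ⧸ U`. -/
theorem out_inv_mul_mul_out_mem (f : F) (y : F ⧸ U) :
    (f • y).out⁻¹ * (f * y.out) ∈ U := by
  rw [← QuotientGroup.eq, QuotientGroup.out_eq', ← smul_eq_mul, ← MulAction.Quotient.smul_mk,
    QuotientGroup.out_eq']

/-- The monomial homomorphism `F → (F ⧸ U → B) ⋊ Perm (F ⧸ U)` induced by `α : U → B`. -/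
noncomputable def monomialHom (α : U →* B) : F →* PermWreath U B where
  toFun f := ⟨fun y => α ⟨_, out_inv_mul_mul_out_mem f (f⁻¹ • y)⟩, MulAction.toPerm f⟩
  map_one' := by
    ext y
    · exact (congrArg α (Subtype.ext (by simp))).trans (map_one α)
    · simp
  map_mul' f g := by
    ext y
    · simp only [SemidirectProduct.mul_left, Pi.mul_apply, mulAutArrow_apply_apply]
      change _ = α _ * α _
      rw [← map_mul]
      congr 1
      ext
      have h1 : (MulAction.toPerm f : Equiv.Perm (F ⧸ U))⁻¹ • y = f⁻¹ • y := rfl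
      simp only [Subgroup.coe_mul, h1, mul_inv_rev, mul_smul, smul_inv_smul]
      group
    · simp [mul_smul]

/-- The map of wreath products induced by a homomorphism of the coefficients. -/
def PermWreath.map {E : Type w} [Group E] (U : Subgroup F) (π : E →* B) :
    PermWreath U E →* PermWreath U B :=
  SemidirectProduct.map (π.compLeft (F ⧸ U)) (MonoidHom.id _) fun _ => rfl

theorem PermWreath.map_surjective {E : Type w} [Group E] {π : E →* B}
    (hπ : Function.Surjective π) : Function.Surjective (PermWreath.map U π) := by
  rintro ⟨b, σ⟩
  choose g hg using fun y => hπ (b y)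
  exact ⟨⟨g, σ⟩, SemidirectProduct.ext (funext hg) rfl⟩

theorem PermWreath.isPGroup_ker_map {E : Type w} [Group E] [Finite E] {p : ℕ} [Fact p.Prime]
    (hE : IsPGroup p E) (π : E →* B) : IsPGroup p (PermWreath.map U π).ker := by
  obtain ⟨n, hn⟩ := IsPGroup.iff_card.1 hE
  rintro ⟨⟨e, σ⟩, hw⟩
  have hσ : σ = 1 := congrArg SemidirectProduct.right hw
  subst hσ
  refine ⟨n, Subtype.ext ?_⟩
  have he : e ^ p ^ n = 1 := funext fun y => by
    rw [Pi.pow_apply, ← hn, pow_card_eq_one']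
    rfl
  change (SemidirectProduct.inl e : PermWreath U E) ^ p ^ n = 1
  rw [← map_pow, he, map_one]

instance {E : Type w} [Group E] [Finite E] [Finite (F ⧸ U)] : Finite (PermWreath U E) :=
  Finite.of_equiv _ SemidirectProduct.equivProd.symm

end MonomialRepresentation

section FreeProP

variable {F : Type u} [Group F] [TopologicalSpace F] [IsTopologicalGroup F] {p : ℕ}

/-- The family `x` satisfies the universal property of a basis of a free pro-`p` group with respect
to finite `p`-groups in the lowest universe. -/
def IsFreeProPBasis (p : ℕ) {d : ℕ} (x : Fin d → F) : Prop :=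
  ∀ (P : Type) [Group P] [Finite P], IsPGroup p P → ∀ g : Fin d → P,
    ∃! φ : F →* P, IsLocallyConstant φ ∧ ∀ i, φ (x i) = g i

omit [IsTopologicalGroup F] in
/-- The universal property of free pro-`p` groups, for finite `p`-groups in any universe. -/
theorem IsFreeProPBasis.existsUnique {d : ℕ} {x : Fin d → F} (hx : IsFreeProPBasis p x)
    {P : Type v} [Group P] [Finite P] (hP : IsPGroup p P) (g : Fin d → P) :
    ∃! φ : F →* P, IsLocallyConstant φ ∧ ∀ i, φ (x i) = g i := by
  have : Small.{0} P := Countable.toSmall P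
  let e : Shrink.{0} P ≃* P := Shrink.mulEquiv
  obtain ⟨φ, ⟨hφ, hφx⟩, huniq⟩ := hx (Shrink.{0} P) (hP.of_equiv e.symm) fun i => e.symm (g i)
  refine ⟨e.toMonoidHom.comp φ, ⟨hφ.comp e, fun i => by simp [hφx]⟩, fun ψ hψ => ?_⟩
  have := huniq (e.symm.toMonoidHom.comp ψ) ⟨hψ.1.comp e.symm, fun i => by simp [hψ.2]⟩
  rw [← this]
  ext
  simp

theorem IsProP.exists_openNormalSubgroup_le (hF : IsProP p F) {s : Set F} (hs : s ∈ 𝓝 1) :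
    ∃ V : OpenNormalSubgroup F, (V.toSubgroup : Set F) ⊆ s := by
  have := hF.compact
  have := hF.totallyDisconnected
  obtain ⟨O, hOs, hO, h1⟩ := mem_nhds_iff.1 hs
  obtain ⟨V, hV⟩ := ProfiniteGrp.exist_openNormalSubgroup_sub_open_nhds_of_one hO h1
  exact ⟨V, fun x hx => hOs (hV hx)⟩

theorem IsProP.isPGroup_of_hom (hF : IsProP p F) {P : Type*} [Group P] {φ : F →* P}
    (hφ : (φ.ker : Set F) ∈ 𝓝 1) : IsPGroup p φ.range := by
  obtain ⟨V, hV⟩ := hF.exists_openNormalSubgroup_le hφ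
  rintro ⟨_, f, rfl⟩
  obtain ⟨n, hn⟩ := hF.isPGroup_quotient V (QuotientGroup.mk f)
  refine ⟨n, Subtype.ext ?_⟩
  have : φ (f ^ p ^ n) = 1 := hV ((QuotientGroup.eq_one_iff _).1 hn)
  simpa using this

/-- A homomorphism to a finite `p`-group defined on a subgroup `H` of a pro-`p` group extends to
an open subgroup, namely to `H V` for an open normal subgroup `V` with `H ∩ V` in the kernel. -/
theorem IsProP.exists_extension (hF : IsProP p F) {H : Subgroup F} {B : Type*} [Group B]
    (φ : H →* B) (hφ : IsLocallyConstant φ) :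
    ∃ (V : OpenNormalSubgroup F) (U : Subgroup F) (hHU : H ≤ U) (hVU : V.toSubgroup ≤ U)
      (α : U →* B), (∀ x : H, α ⟨x, hHU x.2⟩ = φ x) ∧
      ∀ v (hv : v ∈ V.toSubgroup), α ⟨v, hVU hv⟩ = 1 := by
  have hker : φ ⁻¹' {1} ∈ 𝓝 (1 : H) := (hφ.isOpen_fiber 1).mem_nhds (map_one φ)
  rw [nhds_subtype_eq_comap] at hker
  obtain ⟨s, hs, hsker⟩ := mem_comap.1 hker
  obtain ⟨V, hV⟩ := hF.exists_openNormalSubgroup_le (s := s) hs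
  have hVker : ∀ x : H, (x : F) ∈ V.toSubgroup → φ x = 1 := fun x hx => hsker (hV hx)
  have hdec : ∀ u : ↥(H ⊔ V.toSubgroup), ∃ h : H, (h : F)⁻¹ * u ∈ V.toSubgroup := by
    rintro ⟨u, hu⟩
    obtain ⟨h, hh, v, hv, rfl⟩ := Subgroup.mem_sup_of_normal_right.1 hu
    exact ⟨⟨h, hh⟩, by simpa using hv⟩
  choose c hc using hdec
  have hval : ∀ (u : ↥(H ⊔ V.toSubgroup)) (h : H), (h : F)⁻¹ * u ∈ V.toSubgroup →
      φ (c u) = φ h := by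
    intro u h hu
    have : ((c u)⁻¹ * h : F) ∈ V.toSubgroup := by
      have := V.toSubgroup.mul_mem (hc u) (V.toSubgroup.inv_mem hu)
      rwa [mul_inv_rev, inv_inv, mul_assoc, mul_inv_cancel_left] at this
    have := hVker ((c u)⁻¹ * h) this
    rwa [map_mul, map_inv, inv_mul_eq_one] at this
  refine ⟨V, H ⊔ V.toSubgroup, le_sup_left, le_sup_right,
    MonoidHom.mk' (fun u => φ (c u)) fun a b => ?_, fun x => ?_, fun v hv => ?_⟩
  · rw [← map_mul]
    refine hval _ _ ?_
    have h1 := V.isNormal'.conj_mem _ (hc a) (b : F)⁻¹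
    have h2 := V.toSubgroup.mul_mem (hc b) h1
    convert h2 using 1
    simp only [Subgroup.coe_mul]
    group
  · exact hval _ x (by simp)
  · exact (hval _ 1 (by simpa using hv)).trans (map_one φ)

/-- Every subgroup `H` of a free pro-`p` group has the lifting property. A homomorphism defined on
`H` is extended to an open subgroup `U`; inducing up to the wreath product with the permutations of
`F ⧸ U` reduces the problem to the free pro-`p` group itself. -/
theorem IsFreeProPOfFiniteRank.hasPLifting [Fact p.Prime] (hF : IsFreeProPOfFiniteRank p F)
    (H : Subgroup F) : HasPLifting p H := by
  intro E B _ _ _ hE π hπ φ hφ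
  obtain ⟨V, U, hHU, hVU, α, hα, hαV⟩ := hF.1.exists_extension φ hφ
  have := hF.1.compact
  have hfinU : Finite (F ⧸ U) := Subgroup.quotient_finite_of_isOpen _
    (Subgroup.isOpen_mono hVU V.toOpenSubgroup.isOpen)
  have hfinB : Finite B := Finite.of_surjective π hπ
  set Φ := monomialHom α with hΦ
  have hVΦ : V.toSubgroup ≤ Φ.ker := by
    intro v hv
    have hfix : ∀ y : F ⧸ U, v • y = y := by
      intro y
      induction y using QuotientGroup.induction_on with | _ f
      refine (QuotientGroup.eq (s := U)).2 (hVU ?_)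
      have := V.isNormal'.conj_mem _ (V.toSubgroup.inv_mem hv) f⁻¹
      simpa [mul_assoc] using this
    refine SemidirectProduct.ext (funext fun y => ?_) (Equiv.ext hfix)
    have hmem : ((v • v⁻¹ • y).out⁻¹ * (v * (v⁻¹ • y).out)) ∈ V.toSubgroup := by
      have h1 : v⁻¹ • y = y := by rw [inv_smul_eq_iff, hfix]
      rw [h1, hfix]
      have := V.isNormal'.conj_mem _ hv y.out⁻¹
      simpa [mul_assoc] using this
    exact hαV _ hmem
  have hΦker : (Φ.ker : Set F) ∈ 𝓝 1 :=
    mem_of_superset (V.toOpenSubgroup.isOpen.mem_nhds V.toSubgroup.one_mem) hVΦ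
  have hPB : IsPGroup p Φ.range := hF.1.isPGroup_of_hom hΦker
  let PE := Φ.range.comap (PermWreath.map U π)
  have hPE : IsPGroup p PE :=
    hPB.comap_of_ker_isPGroup _ (PermWreath.isPGroup_ker_map hE π)
  obtain ⟨d, x, hx : IsFreeProPBasis p x⟩ := hF.2
  choose g hg using fun i => PermWreath.map_surjective (U := U) hπ (Φ (x i))
  have hgE : ∀ i, g i ∈ PE := fun i => ⟨x i, (hg i).symm⟩
  obtain ⟨Ψ, ⟨hΨ, hΨx⟩, -⟩ := hx.existsUnique hPE fun i => ⟨g i, hgE i⟩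
  have hΨΦ : ∀ f, PermWreath.map U π (Ψ f) = Φ f := by
    have h1 : ((PermWreath.map U π).subgroupComap Φ.range).comp Ψ = Φ.rangeRestrict := by
      refine (hx.existsUnique hPB fun i => Φ.rangeRestrict (x i)).unique
        ⟨hΨ.comp ((PermWreath.map U π).subgroupComap Φ.range), fun i => ?_⟩
        ⟨isLocallyConstant_of_isOpen_ker ?_, fun i => rfl⟩
      · ext1
        rw [MonoidHom.comp_apply, hΨx]
        exact hg i
      · rwa [MonoidHom.ker_rangeRestrict]
    intro f
    exact congrArg Subtype.val (DFunLike.congr_fun h1 f)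
  have hΨright : ∀ f, (Ψ f : PermWreath U E).right = MulAction.toPerm f :=
    fun f => congrArg SemidirectProduct.right (hΨΦ f)
  -- evaluation of the lift at the base point `y₀` of `F ⧸ U`
  let y₀ : F ⧸ U := QuotientGroup.mk 1
  have hy₀ : y₀.out ∈ U := by
    have : (QuotientGroup.mk y₀.out : F ⧸ U) = QuotientGroup.mk 1 := QuotientGroup.out_eq' y₀
    simpa using QuotientGroup.eq.1 this
  have hfix : ∀ u ∈ U, u • y₀ = y₀ := by
    intro u hu
    refine (QuotientGroup.eq (s := U)).2 ?_
    simpa using hu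
  have hconj : ∀ u ∈ U, y₀.out * u * y₀.out⁻¹ ∈ U := fun u hu =>
    U.mul_mem (U.mul_mem hy₀ hu) (U.inv_mem hy₀)
  let ψ : H →* E := MonoidHom.mk'
    (fun h => (Ψ (y₀.out * h * y₀.out⁻¹) : PermWreath U E).left y₀) fun a b => by
      have : y₀.out * ((a * b : H) : F) * y₀.out⁻¹ =
          (y₀.out * a * y₀.out⁻¹) * (y₀.out * b * y₀.out⁻¹) := by
        rw [Subgroup.coe_mul]; group
      rw [this, map_mul, Subgroup.coe_mul, SemidirectProduct.mul_left, Pi.mul_apply, hΨright]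
      congr 1
      change (Ψ _ : PermWreath U E).left ((y₀.out * a * y₀.out⁻¹)⁻¹ • y₀) = _
      rw [hfix _ (U.inv_mem (hconj _ (hHU a.2)))]
  refine ⟨ψ, ?_, fun h => ?_⟩
  · have hc : Continuous fun h : H => y₀.out * (h : F) * y₀.out⁻¹ := by fun_prop
    exact (hΨ.comp_continuous hc).comp fun w => (w : PermWreath U E).left y₀
  · have h1 : π (ψ h) = (Φ (y₀.out * h * y₀.out⁻¹)).left y₀ :=
      congrFun (congrArg SemidirectProduct.left (hΨΦ (y₀.out * h * y₀.out⁻¹))) y₀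
    rw [h1, ← hα]
    change α _ = α _
    congr 1
    ext
    simp only [smul_inv_smul]
    rw [hfix _ (U.inv_mem (hconj _ (hHU h.2)))]
    group

end FreeProP

/-! ### The Zassenhaus filtration: normality, functoriality and finite index -/

section Zassenhaus

variable {p : ℕ} {F : Type u} [Group F] {G : Type v} [Group G]

theorem augmentation_of (p : ℕ) (f : F) : augmentation p F (MonoidAlgebra.of (ZMod p) F f) = 1 := by
  simp [augmentation]

theorem of_sub_one_mem_augmentationIdeal (p : ℕ) (f : F) :
    MonoidAlgebra.of (ZMod p) F f - 1 ∈ augmentationIdeal p F := by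
  rw [augmentationIdeal, RingHom.mem_ker, map_sub, map_one]
  exact sub_eq_zero.2 (augmentation_of p f)

theorem mem_zassenhaus {n : ℕ} {f : F} : f ∈ zassenhaus p F n ↔
    MonoidAlgebra.of (ZMod p) F f - 1 ∈ augmentationIdeal p F ^ n := Iff.rfl

instance zassenhaus_normal (p n : ℕ) : (zassenhaus p F n).Normal := by
  refine ⟨fun f hf g => ?_⟩
  rw [mem_zassenhaus] at hf ⊢
  have h : MonoidAlgebra.of (ZMod p) F (g * f * g⁻¹) - 1 = MonoidAlgebra.of (ZMod p) F g *
      (MonoidAlgebra.of (ZMod p) F f - 1) * MonoidAlgebra.of (ZMod p) F g⁻¹ := by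
    rw [mul_sub, sub_mul, ← map_mul, ← map_mul, mul_one, ← map_mul, mul_inv_cancel, map_one]
  rw [h]
  exact Ideal.mul_mem_right _ _ (Ideal.mul_mem_left _ _ hf)

theorem map_mem_augmentationIdeal_pow (φ : F →* G) (n : ℕ) {a : MonoidAlgebra (ZMod p) F}
    (ha : a ∈ augmentationIdeal p F ^ n) :
    MonoidAlgebra.mapDomainAlgHom (ZMod p) (ZMod p) φ a ∈ augmentationIdeal p G ^ n := by
  have haug : ∀ b, augmentation p G (MonoidAlgebra.mapDomainAlgHom (ZMod p) (ZMod p) φ b) =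
      augmentation p F b := by
    intro b
    have : (augmentation p G).comp (MonoidAlgebra.mapDomainAlgHom (ZMod p) (ZMod p) φ) =
        augmentation p F := by
      ext f
      simp [augmentation]
    exact DFunLike.congr_fun this b
  suffices h : augmentationIdeal p F ^ n ≤ Ideal.comap
      (MonoidAlgebra.mapDomainAlgHom (ZMod p) (ZMod p) φ) (augmentationIdeal p G ^ n) from h ha
  clear ha
  induction n with
  | zero => rw [Submodule.pow_zero, Submodule.pow_zero, Ideal.one_eq_top, Ideal.one_eq_top,
      Ideal.comap_top]
  | succ n ih =>
    rw [Submodule.pow_succ, Ideal.mul_le]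
    intro r hr s hs
    rw [Ideal.mem_comap, map_mul, Submodule.pow_succ]
    refine Ideal.mul_mem_mul (ih hr) ?_
    rw [augmentationIdeal, RingHom.mem_ker] at hs ⊢
    exact (haug s).trans hs

theorem map_mem_zassenhaus (φ : F →* G) {n : ℕ} {f : F} (hf : f ∈ zassenhaus p F n) :
    φ f ∈ zassenhaus p G n := by
  have := map_mem_augmentationIdeal_pow φ n hf
  rw [map_sub, map_one] at this
  simpa [mem_zassenhaus] using this

theorem proPZassenhaus_normal [TopologicalSpace F] (p n : ℕ) : (proPZassenhaus p F n).Normal :=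
  Subgroup.normal_iInf_normal fun _ => (zassenhaus_normal p n).comap _

theorem isClosed_proPZassenhaus [TopologicalSpace F] [IsTopologicalGroup F] (p n : ℕ) :
    IsClosed (proPZassenhaus p F n : Set F) := by
  rw [proPZassenhaus, Subgroup.coe_iInf]
  refine isClosed_iInter fun U => ?_
  refine Subgroup.isClosed_of_isOpen _ (Subgroup.isOpen_mono (H₁ := U.toSubgroup) ?_
    U.toOpenSubgroup.isOpen)
  intro x hx
  have : (QuotientGroup.mk' U.toSubgroup) x = 1 := (QuotientGroup.eq_one_iff _).2 hx
  rw [Subgroup.mem_comap, this]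
  exact Subgroup.one_mem _

theorem map_mem_proPZassenhaus [TopologicalSpace F] [IsTopologicalGroup F] [TopologicalSpace G]
    [IsTopologicalGroup G] {φ : F →* G} (hφ : Continuous φ) {n : ℕ} {f : F}
    (hf : f ∈ proPZassenhaus p F n) : φ f ∈ proPZassenhaus p G n := by
  rw [proPZassenhaus, Subgroup.mem_iInf] at hf ⊢
  intro U
  let V : OpenNormalSubgroup F :=
    { U.toOpenSubgroup.comap φ hφ with isNormal' := U.isNormal'.comap φ }
  have hV := hf V
  have : V.toSubgroup.Normal := V.isNormal'
  let ψ : F ⧸ V.toSubgroup →* G ⧸ U.toSubgroup := QuotientGroup.map _ _ φ le_rfl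
  exact map_mem_zassenhaus ψ hV

theorem pow_mem_zassenhaus [hp : Fact p.Prime] (x : F) (n : ℕ) : x ^ p ^ n ∈ zassenhaus p F n := by
  rw [mem_zassenhaus]
  have : CharP (MonoidAlgebra (ZMod p) F) p :=
    charP_of_injective_algebraMap (FaithfulSMul.algebraMap_injective (ZMod p) _) p
  have h : MonoidAlgebra.of (ZMod p) F (x ^ p ^ n) - 1 =
      (MonoidAlgebra.of (ZMod p) F x - 1) ^ p ^ n := by
    rw [sub_pow_char_pow_of_commute _ _ (Commute.one_right _), one_pow, map_pow]
  rw [h]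
  exact Ideal.pow_le_pow_right (Nat.lt_pow_self hp.out.one_lt).le
    (Ideal.pow_mem_pow (of_sub_one_mem_augmentationIdeal p x) _)

/-- Modulo each power of the augmentation ideal the group algebra of a finitely generated group is
finite-dimensional: it is spanned by `1` and the products of fewer than `n` factors `s - 1`, with
`s` in a finite generating set. -/
theorem exists_fg_sup_augmentationIdeal_pow_eq_top [Group.FG F] (p n : ℕ) :
    ∃ W : Submodule (ZMod p) (MonoidAlgebra (ZMod p) F), W.FG ∧
      W ⊔ (augmentationIdeal p F ^ n).restrictScalars (ZMod p) = ⊤ := by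
  obtain ⟨S, hS⟩ := Group.FG.out (G := F)
  let ι := MonoidAlgebra.of (ZMod p) F
  let T : Submodule (ZMod p) (MonoidAlgebra (ZMod p) F) :=
    Submodule.span (ZMod p) ((fun s => ι s - 1) '' (S : Set F))
  have hTfg : T.FG := Submodule.fg_span (S.finite_toSet.image _)
  have hTaug : ∀ t ∈ T, t ∈ augmentationIdeal p F := by
    have : T ≤ (augmentationIdeal p F).restrictScalars (ZMod p) := by
      refine Submodule.span_le.2 ?_
      rintro _ ⟨s, -, rfl⟩
      exact of_sub_one_mem_augmentationIdeal p s
    exact fun t ht => this ht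
  set M : Submodule (ZMod p) (MonoidAlgebra (ZMod p) F) := ⊤ * T
  have hMl : ∀ a, ∀ m ∈ M, a * m ∈ M := by
    intro a m hm
    have : (⊤ : Submodule (ZMod p) (MonoidAlgebra (ZMod p) F)) * M ≤ M := by
      rw [← mul_assoc]
      exact Submodule.mul_le.2 fun _ _ _ ht => Submodule.mul_mem_mul trivial ht
    exact this (Submodule.mul_mem_mul trivial hm)
  have hgen : ∀ g : F, ι g - 1 ∈ M := by
    intro g
    have hg : g ∈ Subgroup.closure (S : Set F) := by rw [hS]; trivial
    induction hg using Subgroup.closure_induction with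
    | mem s hs =>
      rw [← one_mul (ι s - 1)]
      exact Submodule.mul_mem_mul trivial (Submodule.subset_span ⟨s, hs, rfl⟩)
    | one => simp
    | mul g h _ _ hg hh =>
      have : ι (g * h) - 1 = ι g * (ι h - 1) + (ι g - 1) := by rw [map_mul]; noncomm_ring
      rw [this]
      exact M.add_mem (hMl _ _ hh) hg
    | inv g _ hg =>
      have : ι g⁻¹ - 1 = -(ι g⁻¹ * (ι g - 1)) := by
        rw [mul_sub, ← map_mul, inv_mul_cancel, map_one, mul_one, neg_sub]
      rw [this]
      exact M.neg_mem (hMl _ _ hg)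
  have htop : (1 : Submodule (ZMod p) (MonoidAlgebra (ZMod p) F)) ⊔ M = ⊤ := by
    rw [eq_top_iff]
    intro a _
    induction a using MonoidAlgebra.induction_on with
    | of g =>
      have h1 : ι g = 1 + (ι g - 1) := by abel
      change ι g ∈ _
      rw [h1]
      exact Submodule.add_mem_sup (Submodule.one_le.1 le_rfl) (hgen g)
    | add a b ha hb => exact Submodule.add_mem _ (ha trivial) (hb trivial)
    | smul c a ha => exact Submodule.smul_mem _ c (ha trivial)
  induction n with
  | zero => exact ⟨⊥, Submodule.fg_bot, by simp⟩
  | succ n ih =>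
    obtain ⟨W, hW, hWtop⟩ := ih
    refine ⟨1 ⊔ W * T, Submodule.FG.sup ?_ (hW.mul hTfg), ?_⟩
    · rw [Submodule.one_eq_span]
      exact Submodule.fg_span_singleton 1
    rw [eq_top_iff, ← htop, sup_assoc]
    refine sup_le_sup_left ?_ 1
    change ⊤ * T ≤ _
    rw [← hWtop, Submodule.sup_mul]
    refine sup_le_sup_left ?_ _
    rw [Submodule.mul_le]
    intro a ha t ht
    change a * t ∈ augmentationIdeal p F ^ (n + 1)
    rw [Submodule.pow_succ]
    exact Ideal.mul_mem_mul ha (hTaug t ht)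

theorem finite_quotient_zassenhaus [Group.FG F] [hp : Fact p.Prime] (n : ℕ) :
    Finite (F ⧸ zassenhaus p F n) := by
  obtain ⟨W, hW, hWtop⟩ := exists_fg_sup_augmentationIdeal_pow_eq_top (F := F) p n
  set D := (augmentationIdeal p F ^ n).restrictScalars (ZMod p)
  have hfin : Module.Finite (ZMod p) (MonoidAlgebra (ZMod p) F ⧸ D) := by
    refine ⟨?_⟩
    have : W.map D.mkQ = ⊤ := by
      rw [eq_top_iff, ← D.range_mkQ, LinearMap.range_eq_map, ← hWtop, Submodule.map_sup]
      simp
    rw [← this]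
    exact hW.map _
  have : Finite (MonoidAlgebra (ZMod p) F ⧸ D) := Module.finite_of_finite (ZMod p)
  refine Finite.of_injective
    (fun q : F ⧸ zassenhaus p F n => D.mkQ (MonoidAlgebra.of (ZMod p) F q.out)) fun q q' h => ?_
  have hd : MonoidAlgebra.of (ZMod p) F q'.out - MonoidAlgebra.of (ZMod p) F q.out ∈
      augmentationIdeal p F ^ n := (Submodule.Quotient.eq D).1 h.symm
  rw [← QuotientGroup.out_eq' q, ← QuotientGroup.out_eq' q', QuotientGroup.eq, mem_zassenhaus]
  have := Ideal.mul_mem_left _ (MonoidAlgebra.of (ZMod p) F q.out⁻¹) hd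
  rwa [mul_sub, ← map_mul, ← map_mul, inv_mul_cancel, map_one] at this

end Zassenhaus

/-! ### Permutational and aspherical pro-`p` presentations -/

section ProP

variable {F : Type u} [Group F] [TopologicalSpace F] [IsTopologicalGroup F] {p : ℕ}
  [hp : Fact p.Prime]

/-- A closed normal subgroup `R` of a pro-`p` group gives a quasirational presentation if its
characters can be lifted. -/
theorem IsProP.isProPQuasirational (hF : IsProP p F) {R : Subgroup F} [R.Normal]
    (hR : IsClosed (R : Set F)) (hlift : ∀ N : Subgroup F, CharsLift p R N) :
    IsProPQuasirational p R := by
  intro n _ x hx hxp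
  have := proPZassenhaus_normal (F := F) p n
  set N := R ⊔ proPZassenhaus p F n
  have : (⁅R, N⁆).topologicalClosure.Normal := Subgroup.is_normal_topologicalClosure _
  refine mem_of_pow_mem_of_charsLift hR (hlift N) ?_ hx hxp
  refine hF.charsSeparate ?_ ?_ (Subgroup.isClosed_topologicalClosure _)
  · exact Subgroup.topologicalClosure_minimal _ (Subgroup.commutator_le_left R N) hR
  · exact (Subgroup.commutator_mono le_rfl le_sup_left).trans (Subgroup.le_topologicalClosure _)

omit hp in
/-- Characters of `R` are the same as characters of the relation module. -/
theorem IsCharOn.exists_relationModule_hom {C : Type*} [AddCommGroup C] {R : Subgroup F}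
    {f : F → C} (hf : IsCharOn R f) : ∃ φ : RelationModule R →* Multiplicative C,
      IsLocallyConstant φ ∧
        ∀ x : R, φ (QuotientGroup.mk x : RelationModule R) = Multiplicative.ofAdd (f x) := by
  have hker : (commutator R).topologicalClosure ≤ hf.toHom.ker :=
    Subgroup.topologicalClosure_minimal _ (Abelianization.commutator_subset_ker _)
      (hf.isLocallyConstant_toHom.isClosed_fiber 1)
  refine ⟨QuotientGroup.lift _ hf.toHom hker, ?_, fun x => rfl⟩
  intro s
  rw [← (QuotientGroup.isQuotientMap_mk (N := (commutator R).topologicalClosure)).isOpen_preimage]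
  exact hf.isLocallyConstant_toHom s

omit hp in
theorem exists_isCharOn_of_relationModule_hom {C : Type*} [AddCommGroup C] {R : Subgroup F}
    {φ : RelationModule R →* Multiplicative C} (hφ : IsLocallyConstant φ) :
    ∃ f : F → C, IsCharOn R f ∧ ∀ x : R, f x = (φ (QuotientGroup.mk x : RelationModule R)).toAdd :=
  exists_isCharOn_of_hom (φ.comp (QuotientGroup.mk' _))
    (hφ.comp_continuous QuotientGroup.continuous_mk)

omit hp in
/-- A character is determined by its values on a profinite basis of the relation module. -/
theorem IsProfiniteBasis.isCharOn_eq {R : Subgroup F} {T : Set (RelationModule R)}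
    (hT : IsProfiniteBasis p T) {k : ℕ} {f g : F → ZMod (p ^ k)} (hf : IsCharOn R f)
    (hg : IsCharOn R g)
    (hfg : ∀ x : R, (QuotientGroup.mk x : RelationModule R) ∈ T → f x = g x) {x : F}
    (hx : x ∈ R) : f x = g x := by
  obtain ⟨φ, hφ, hφf⟩ := hf.exists_relationModule_hom
  obtain ⟨γ, hγ, hγg⟩ := hg.exists_relationModule_hom
  have hloc : IsLocallyConstant fun t : T => (φ t).toAdd :=
    (hφ.comp Multiplicative.toAdd).comp_continuous continuous_subtype_val
  have : φ = γ := (hT k _ hloc).unique ⟨hφ, fun t => rfl⟩ ⟨hγ, fun t => by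
    obtain ⟨⟨x⟩, hx⟩ := t
    change γ (QuotientGroup.mk x) = φ (QuotientGroup.mk x)
    rw [hγg, hφf, hfg x hx]⟩
  have h1 := hφf ⟨x, hx⟩
  rw [this, hγg ⟨x, hx⟩] at h1
  exact (Multiplicative.ofAdd.injective h1).symm

omit hp in
/-- Characters of `R` lift by lifting their values on an invariant profinite basis. -/
theorem charsLift_of_isPermutational {R : Subgroup F} [hRn : R.Normal]
    (hperm : IsPermutationalRelationModule p R) (N : Subgroup F) : CharsLift p R N := by
  obtain ⟨T, -, hT, hTinv⟩ := hperm
  intro k θ hθ hinv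
  have hsurj := ZMod.castHom_surjective (pow_dvd_pow p k.le_succ)
  obtain ⟨φ, hφ, hφθ⟩ := hθ.exists_relationModule_hom
  obtain ⟨φ', ⟨hφ', hφ'T⟩, -⟩ := hT (k + 1) (fun t => Function.surjInv hsurj (φ t).toAdd)
    ((hφ.comp fun y => Function.surjInv hsurj y.toAdd).comp_continuous continuous_subtype_val)
  obtain ⟨θ', hθ', hθ'φ⟩ := exists_isCharOn_of_relationModule_hom hφ'
  have hval : ∀ x : R, (QuotientGroup.mk x : RelationModule R) ∈ T →
      θ' x = Function.surjInv hsurj (θ x) := by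
    intro x hx
    rw [hθ'φ, hφ'T ⟨_, hx⟩, hφθ]
    rfl
  refine ⟨θ', hθ', fun n hn x hx => ?_, fun x hx => ?_⟩
  · refine hT.isCharOn_eq (hθ'.conj fun l hl => hRn.conj_mem l hl n) hθ' (fun x hx => ?_) hx
    have := hval _ (hTinv n x hx)
    rw [hval x hx, ← hinv n hn x x.2]
    exact this
  · refine hT.isCharOn_eq (hθ'.map
      (ZMod.castHom (pow_dvd_pow p k.le_succ) (ZMod (p ^ k))).toAddMonoidHom) hθ
      (fun x hx => ?_) hx
    rw [hval x hx]
    exact Function.surjInv_eq hsurj _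

/-- The conjugates of the elements of `S`. -/
def conjugates (S : Set F) : Set F := {a | ∃ r ∈ S, ∃ f : F, f * r * f⁻¹ = a}

omit [TopologicalSpace F] [IsTopologicalGroup F] in
theorem conj_mem_conjugates {S : Set F} (x : F) {a : F} (ha : a ∈ conjugates S) :
    x * a * x⁻¹ ∈ conjugates S := by
  obtain ⟨r, hr, f, rfl⟩ := ha
  exact ⟨r, hr, x * f, by group⟩

omit [TopologicalSpace F] [IsTopologicalGroup F] in
theorem closure_conjugates (S : Set F) :
    Subgroup.closure (conjugates S) = Subgroup.normalClosure S := by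
  rw [Subgroup.normalClosure]
  congr 1
  ext a
  simp [conjugates, Group.mem_conjugatesOfSet_iff, isConj_iff]

theorem conjugates_subset_closedNormalClosure (S : Set F) :
    conjugates S ⊆ closedNormalClosure S := by
  rintro _ ⟨r, hr, f, rfl⟩
  exact conj_mem_closedNormalClosure S ⟨r, hr⟩ f

theorem isClosed_closedNormalClosure (S : Set F) : IsClosed (closedNormalClosure S : Set F) :=
  Subgroup.isClosed_topologicalClosure _

theorem closedNormalClosure_mono {S S' : Set F} (h : S' ⊆ S) :
    closedNormalClosure S' ≤ closedNormalClosure S :=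
  Subgroup.topologicalClosure_mono (Subgroup.normalClosure_mono h)

/-- Translating an equality of classes in the relation module by an element of `F`. -/
theorem relatorClass_eq_of_relatorClass_eq {S : Set F} {r r' : S} {f f' : F}
    (h : relatorClass S r f = relatorClass S r' f') (g : F) :
    relatorClass S r (g * f) = relatorClass S r' (g * f') := by
  rw [relatorClass, relatorClass, QuotientGroup.eq] at h ⊢
  set R := closedNormalClosure S
  let c : R →* R := (MulAut.conjNormal g : MulAut R).toMonoidHom
  have hc : Continuous c := by
    refine Continuous.subtype_mk (f := fun x : R => g * (x : F) * g⁻¹) ?_ _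
    fun_prop
  have hle : (commutator R).topologicalClosure ≤ (commutator R).topologicalClosure.comap c := by
    refine Subgroup.topologicalClosure_minimal _ ?_
      ((Subgroup.isClosed_topologicalClosure _).preimage hc)
    rw [← Subgroup.map_le_iff_le_comap]
    refine le_trans ?_ (Subgroup.le_topologicalClosure _)
    rw [commutator_def, Subgroup.map_commutator]
    exact Subgroup.commutator_mono le_top le_top
  have h' := Subgroup.mem_comap.1 (hle h)
  convert h' using 1
  refine Subtype.ext ?_
  change (g * f * r * (g * f)⁻¹)⁻¹ * (g * f' * r' * (g * f')⁻¹) =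
    g * ((f * r * f⁻¹)⁻¹ * (f' * r' * f'⁻¹)) * g⁻¹
  group

omit hp in
/-- For an aspherical presentation with relators `S` and a subset `S'`, every locally constant
`R`-invariant function on the conjugates of `S'` extends to a character of `R`: it is extended by
`0` to the conjugates of the other relators. The stabilizer condition makes this well defined. -/
theorem IsProPAspherical.charExtends (hF : IsProP p F) {S S' : Set F} (hS : S.Finite)
    (hasph : IsProPAspherical p S) (hS' : S' ⊆ S) (k : ℕ) :
    CharExtends (conjugates S') (closedNormalClosure S) (p ^ k) := by
  classical
  intro h hloc hinv
  have := hF.compact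
  have := hF.hausdorff
  have : Finite S := hS
  obtain ⟨hT, hstab⟩ := hasph
  set R := closedNormalClosure S with hRdef
  have hRc : IsClosed (R : Set F) := isClosed_closedNormalClosure S
  let H : S × F → ZMod (p ^ k) := fun a =>
    if (a.1 : F) ∈ S' then h (a.2 * a.1 * a.2⁻¹) else 0
  have hHeq : ∀ a b : S × F, relatorClass S a.1 a.2 = relatorClass S b.1 b.2 → H a = H b := by
    rintro ⟨r, f⟩ ⟨r', f'⟩ hab
    obtain ⟨s, ⟨⟨j, hj⟩, -⟩, hs⟩ := hstab r
    have h1 := relatorClass_eq_of_relatorClass_eq hab f'⁻¹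
    simp only [inv_mul_cancel] at h1
    obtain ⟨rfl, hmem⟩ := hs r' _ h1
    by_cases hr : (r' : F) ∈ S'
    · simp only [H, if_pos hr]
      obtain ⟨ρ, hρ, c, hc, hρc⟩ := Subgroup.mem_sup_of_normal_left.1 hmem
      have hcomm : c * r' = r' * c := by
        have hle : (Subgroup.zpowers s).topologicalClosure ≤ Subgroup.centralizer {(r' : F)} := by
          refine Subgroup.topologicalClosure_minimal _ ?_ (Set.isClosed_centralizer _)
          rw [Subgroup.zpowers_le, Subgroup.mem_centralizer_singleton_iff, hj]
          exact (Commute.self_pow s _).eq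
        exact Subgroup.mem_centralizer_singleton_iff.1 (hle hc)
      have hf : f = f' * ρ * c := by rw [mul_assoc, hρc]; group
      have hconj : f * r' * f⁻¹ =
          (f' * ρ * f'⁻¹) * (f' * r' * f'⁻¹) * (f' * ρ * f'⁻¹)⁻¹ := by
        have hc' : c * r' * c⁻¹ = r' := by rw [hcomm]; group
        calc f * r' * f⁻¹ = f' * ρ * (c * r' * c⁻¹) * ρ⁻¹ * f'⁻¹ := by rw [hf]; group
          _ = _ := by rw [hc']; group
      rw [hconj]
      exact hinv _ ((closedNormalClosure_normal S).conj_mem _ hρ f') _ ⟨r', hr, f', rfl⟩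
    · simp only [H, if_neg hr]
  have hHloc : IsLocallyConstant H := by
    rw [IsLocallyConstant.iff_eventually_eq]
    rintro ⟨r, f⟩
    rw [nhds_prod_eq, nhds_discrete, pure_prod, eventually_map]
    by_cases hr : (r : F) ∈ S'
    · simp only [H, if_pos hr]
      have hc : ContinuousOn (fun y : F => y * (r : F) * y⁻¹) Set.univ := by fun_prop
      have := hloc.comp hc fun y _ => ⟨r, hr, y, rfl⟩
      simpa using this f trivial
    · simp [H, if_neg hr]
  let T := Set.range fun a : S × F => relatorClass S a.1 a.2
  let q : S × F → T := fun a => ⟨relatorClass S a.1 a.2, a, rfl⟩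
  have hq : Continuous q := by
    refine Continuous.subtype_mk (QuotientGroup.continuous_mk.comp ?_) _
    refine Continuous.subtype_mk ?_ _
    have : Continuous fun a : S × F => a.2 * (a.1 : F) * a.2⁻¹ := by fun_prop
    exact this
  have hqsurj : Function.Surjective q := by
    rintro ⟨_, a, rfl⟩
    exact ⟨a, rfl⟩
  have : IsClosed ((commutator R).topologicalClosure : Set R) :=
    Subgroup.isClosed_topologicalClosure _
  have : T2Space (RelationModule R) := inferInstance
  have hqquot : IsQuotientMap q := IsQuotientMap.of_surjective_continuous hqsurj hq
  let H' : T → ZMod (p ^ k) := fun t => H (Function.surjInv hqsurj t)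
  have hH'q : ∀ a, H' (q a) = H a := fun a =>
    hHeq _ _ (congrArg Subtype.val (Function.surjInv_eq hqsurj (q a)))
  have hH'loc : IsLocallyConstant H' := by
    intro s
    rw [← hqquot.isOpen_preimage]
    have : q ⁻¹' (H' ⁻¹' s) = H ⁻¹' s := by
      ext a
      simp [hH'q]
    rw [this]
    exact hHloc s
  obtain ⟨φ, ⟨hφ, hφT⟩, -⟩ := hT k H' hH'loc
  obtain ⟨f, hf, hfφ⟩ := exists_isCharOn_of_relationModule_hom hφ
  refine ⟨f, hf, ?_⟩
  rintro _ ⟨r, hr, g, rfl⟩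
  have h1 := hfφ ⟨g * r * g⁻¹, conj_mem_closedNormalClosure S ⟨r, hS' hr⟩ g⟩
  have h2 := hφT (q (⟨r, hS' hr⟩, g))
  rw [hH'q] at h2
  refine h1.trans ((congrArg Multiplicative.toAdd h2).trans ?_)
  simp [H, hr]

/-- Characters of the closed normal subgroup generated by a subset of the relators of an aspherical
presentation lift. -/
theorem IsProPAspherical.charsLift (hF : IsFreeProPOfFiniteRank p F) {S S' : Set F}
    (hS : S.Finite) (hasph : IsProPAspherical p S) (hS' : S' ⊆ S) (N : Subgroup F) :
    CharsLift p (closedNormalClosure S') N := by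
  set R' := closedNormalClosure S'
  set R := closedNormalClosure S
  have hR'R : R' ≤ R := closedNormalClosure_mono hS'
  have hAR' : conjugates S' ⊆ R' := conjugates_subset_closedNormalClosure S'
  refine charsLift_of_charExtends (isClosed_closedNormalClosure S') hAR'
    (by rw [closure_conjugates]; rfl) (fun x a ha => conj_mem_conjugates x ha)
    fun k θ hθ _ => ?_
  have hker : ∀ᶠ y in 𝓝[R'] (1 : F), θ y = 0 := by
    have := hθ.locConst 1 R'.one_mem
    rwa [hθ.map_one] at this
  rw [eventually_nhdsWithin_iff] at hker
  obtain ⟨V, hV⟩ := hF.1.exists_openNormalSubgroup_le hker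
  -- the character is invariant under the relatively open subgroup `L` of `R`
  set L := R ⊓ (R' ⊔ V.toSubgroup)
  have hVn : V.toSubgroup.Normal := V.isNormal'
  have hLn : ∀ x ∈ R, ∀ l ∈ L, x * l * x⁻¹ ∈ L := fun x hx l hl =>
    ⟨R.mul_mem (R.mul_mem hx hl.1) (R.inv_mem hx),
      (inferInstance : (R' ⊔ V.toSubgroup).Normal).conj_mem l hl.2 x⟩
  have hR'L : R' ≤ L := le_inf hR'R le_sup_left
  have hVnhds : (V.toSubgroup : Set F) ∈ 𝓝 1 :=
    V.toOpenSubgroup.isOpen.mem_nhds V.toSubgroup.one_mem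
  have hRVL : ∀ x ∈ R, x ∈ V.toSubgroup → x ∈ L := fun x hx hxV =>
    ⟨hx, (le_sup_right : V.toSubgroup ≤ R' ⊔ V.toSubgroup) hxV⟩
  have hLopen : (L : Set F) ∈ 𝓝[R] 1 := by
    filter_upwards [self_mem_nhdsWithin, mem_nhdsWithin_of_mem_nhds hVnhds] with x hx hxV
    exact hRVL x hx hxV
  have hidx : ∃ m, L.relIndex R = p ^ m := by
    have := hF.1.compact
    have : Finite (F ⧸ V.toSubgroup) :=
      Subgroup.quotient_finite_of_isOpen _ V.toOpenSubgroup.isOpen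
    have : V.toSubgroup.FiniteIndex := Subgroup.finiteIndex_of_finite_quotient
    have : (R' ⊔ V.toSubgroup).FiniteIndex := Subgroup.finiteIndex_of_le le_sup_right
    have hn : (L.subgroupOf R).Normal := ⟨fun l hl x => hLn x x.2 l hl⟩
    have : (L.subgroupOf R).FiniteIndex := by
      rw [Subgroup.inf_subgroupOf_left]
      infer_instance
    have hP : IsPGroup p (R ⧸ L.subgroupOf R) := by
      intro x
      induction x using QuotientGroup.induction_on with | _ x
      obtain ⟨n, hn⟩ := hF.1.isPGroup_quotient V (QuotientGroup.mk (x : F))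
      refine ⟨n, (QuotientGroup.eq_one_iff (N := L.subgroupOf R) (x ^ p ^ n)).2 ?_⟩
      exact hRVL _ (R.pow_mem x.2 _) ((QuotientGroup.eq_one_iff _).1 hn)
    exact IsPGroup.iff_card.1 hP
  obtain ⟨m, hm⟩ := hidx
  have hbase : CharExtends (conjugates S') R p := by
    have := hasph.charExtends hF.1 hS hS' 1
    rwa [pow_one] at this
  have hL : CharExtends (conjugates S') L p :=
    CharExtends.of_relIndex_eq_prime_pow (hAR'.trans hR'L) m R inf_le_left hLn hm hLopen
      (fun M _ _ => hF.hasPLifting M) (fun x _ a ha => conj_mem_conjugates x ha) hbase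
  refine ⟨L, hR'L, hL.prime_pow (hF.hasPLifting L) (hAR'.trans hR'L) _, ?_⟩
  rintro l ⟨-, hl⟩ x hx
  obtain ⟨ρ, hρ, v, hv, rfl⟩ := Subgroup.mem_sup_of_normal_left.1 hl
  have hR'n := closedNormalClosure_normal S'
  have hvx : v * x * v⁻¹ ∈ R' := hR'n.conj_mem x hx v
  have h1 : θ (v * x * v⁻¹ * x⁻¹) = 0 := by
    refine hV ?_ (R'.mul_mem hvx (R'.inv_mem hx))
    have := V.toSubgroup.mul_mem hv (hVn.conj_mem _ (V.toSubgroup.inv_mem hv) x)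
    simpa [mul_assoc] using this
  have h2 := hθ.map_mul _ (R'.mul_mem hvx (R'.inv_mem hx)) x hx
  rw [inv_mul_cancel_right, h1, zero_add] at h2
  rw [← h2, ← hθ.map_conj hvx hρ]
  congr 1
  group

end ProP

/-! ### Independence of the pro-`p` presentation -/

section Lifting

variable {p : ℕ}

theorem IsProP.eq_of_forall_mk_eq {G : Type u} [Group G] [TopologicalSpace G]
    [IsTopologicalGroup G] (hG : IsProP p G) {a b : G}
    (h : ∀ V : OpenNormalSubgroup G, (QuotientGroup.mk a : G ⧸ V.toSubgroup) = QuotientGroup.mk b) :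
    a = b := by
  have := hG.hausdorff
  by_contra hab
  have hne : a⁻¹ * b ≠ 1 := fun h => hab (inv_mul_eq_one.1 h)
  obtain ⟨V, hV⟩ := hG.exists_openNormalSubgroup_le (isOpen_ne.mem_nhds hne.symm)
  exact hV (QuotientGroup.eq.1 (h V)) rfl

variable {F : Type u} [Group F] [TopologicalSpace F] [IsTopologicalGroup F]
  {M : Type v} [Group M] [TopologicalSpace M] [IsTopologicalGroup M]

/-- The universal property of a free pro-`p` group with respect to all pro-`p` groups: the
homomorphisms to the finite quotients are compatible and define elements of the limit by
compactness. -/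
theorem IsFreeProPBasis.exists_continuous_hom {d : ℕ} {x : Fin d → F} (hx : IsFreeProPBasis p x)
    (hM : IsProP p M) (y : Fin d → M) : ∃ α : F →* M, Continuous α ∧ ∀ i, α (x i) = y i := by
  have := hM.compact
  have hfin : ∀ V : OpenNormalSubgroup M, Finite (M ⧸ V.toSubgroup) := fun V =>
    Subgroup.quotient_finite_of_isOpen _ V.toOpenSubgroup.isOpen
  have hex := fun V : OpenNormalSubgroup M =>
    hx.existsUnique (hM.isPGroup_quotient V) fun i => (QuotientGroup.mk (y i) : M ⧸ V.toSubgroup)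
  choose φ hφ huniq using hex
  have hcompat : ∀ (V W : OpenNormalSubgroup M) (hVW : V.toSubgroup ≤ W.toSubgroup) (f : F) (m : M),
      φ V f = QuotientGroup.mk m → φ W f = QuotientGroup.mk m := by
    intro V W hVW f m hm
    let ρ : M ⧸ V.toSubgroup →* M ⧸ W.toSubgroup := QuotientGroup.map _ _ (MonoidHom.id M) hVW
    have : ρ.comp (φ V) = φ W := huniq W _ ⟨(hφ V).1.comp ρ, fun i => by
      rw [MonoidHom.comp_apply, (hφ V).2 i]
      rfl⟩
    rw [← this, MonoidHom.comp_apply, hm]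
    rfl
  have hpt : ∀ f : F, ∃ m : M, ∀ V : OpenNormalSubgroup M, φ V f = QuotientGroup.mk m := by
    intro f
    let C : OpenNormalSubgroup M → Set M := fun V => {m | φ V f = QuotientGroup.mk m}
    have hC : ∀ V, IsClosed (C V) := by
      intro V
      have hc : Continuous (QuotientGroup.mk : M → M ⧸ V.toSubgroup) := QuotientGroup.continuous_mk
      have : DiscreteTopology (M ⧸ V.toSubgroup) :=
        inferInstanceAs (DiscreteTopology (M ⧸ V.toOpenSubgroup.toSubgroup))
      exact isClosed_eq continuous_const hc
    have : Nonempty (OpenNormalSubgroup M) := ⟨(hM.exists_openNormalSubgroup_le univ_mem).choose⟩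
    obtain ⟨m, hm⟩ := IsCompact.nonempty_iInter_of_directed_nonempty_isCompact_isClosed C
      (fun V W => ⟨V ⊓ W, fun m hm => hcompat _ V inf_le_left f m hm,
        fun m hm => hcompat _ W inf_le_right f m hm⟩)
      (fun V => by
        obtain ⟨m, hm⟩ := QuotientGroup.mk_surjective (φ V f)
        exact ⟨m, hm.symm⟩)
      (fun V => (hC V).isCompact) hC
    exact ⟨m, fun V => Set.mem_iInter.1 hm V⟩
  choose α hα using hpt
  let α' : F →* M := MonoidHom.mk' α fun f g => hM.eq_of_forall_mk_eq fun V => by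
    rw [← hα, map_mul, hα, hα]
    rfl
  refine ⟨α', ?_, fun i => hM.eq_of_forall_mk_eq fun V => ?_⟩
  · refine continuous_of_continuousAt_one α' ?_
    intro s hs
    rw [map_one] at hs
    obtain ⟨V, hV⟩ := hM.exists_openNormalSubgroup_le hs
    have hker : φ V ⁻¹' {1} ∈ 𝓝 (1 : F) := ((hφ V).1.isOpen_fiber 1).mem_nhds (map_one _)
    refine mem_map.2 (mem_of_superset hker fun f hf => hV ?_)
    have h1 : φ V f = 1 := hf
    rw [hα] at h1
    exact (QuotientGroup.eq_one_iff _).1 h1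
  · exact (hα (x i) V).symm.trans ((hφ V).2 i)

/-- Free pro-`p` groups are projective. -/
theorem IsFreeProPOfFiniteRank.exists_lift (hF : IsFreeProPOfFiniteRank p F) (hM : IsProP p M)
    {G : Type w} [Group G] [TopologicalSpace G] [IsTopologicalGroup G] (hG : IsProP p G)
    {f : F →* G} (hf : Continuous f) {π : M →* G} (hπ : Continuous π)
    (hsurj : Function.Surjective π) :
    ∃ α : F →* M, Continuous α ∧ ∀ x, π (α x) = f x := by
  obtain ⟨-, d, x, hx : IsFreeProPBasis p x⟩ := hF
  choose y hy using fun i => hsurj (f (x i))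
  obtain ⟨α, hα, hαx⟩ := hx.exists_continuous_hom hM y
  refine ⟨α, hα, fun z => hG.eq_of_forall_mk_eq fun W => ?_⟩
  have := hG.compact
  have : Finite (G ⧸ W.toSubgroup) :=
    Subgroup.quotient_finite_of_isOpen _ W.toOpenSubgroup.isOpen
  have : DiscreteTopology (G ⧸ W.toSubgroup) :=
    inferInstanceAs (DiscreteTopology (G ⧸ W.toOpenSubgroup.toSubgroup))
  have hloc : ∀ {γ : F →* G}, Continuous γ →
      IsLocallyConstant ((QuotientGroup.mk' W.toSubgroup).comp γ) := fun hγ =>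
    (IsLocallyConstant.iff_continuous _).2 (QuotientGroup.continuous_mk.comp hγ)
  have h := (hx.existsUnique (hG.isPGroup_quotient W)
    fun i => (QuotientGroup.mk (f (x i)) : G ⧸ W.toSubgroup)).unique
    (y₁ := (QuotientGroup.mk' W.toSubgroup).comp (π.comp α))
    (y₂ := (QuotientGroup.mk' W.toSubgroup).comp f)
    ⟨hloc (hπ.comp hα), fun i => by simp [hαx, hy]⟩ ⟨hloc hf, fun i => rfl⟩
  exact DFunLike.congr_fun h z

end Lifting

section Independence

variable {p : ℕ} {F₁ : Type v} [Group F₁] [TopologicalSpace F₁] [IsTopologicalGroup F₁]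
  {F₂ : Type w} [Group F₂] [TopologicalSpace F₂] [IsTopologicalGroup F₂]

theorem closure_commutator_le_comap {α : F₁ →* F₂} (hα : Continuous α) {A B : Subgroup F₁}
    {C D : Subgroup F₂} (hAC : A ≤ C.comap α) (hBD : B ≤ D.comap α) :
    ⁅A, B⁆.topologicalClosure ≤ ⁅C, D⁆.topologicalClosure.comap α := by
  refine Subgroup.topologicalClosure_minimal _ ?_
    ((Subgroup.isClosed_topologicalClosure _).preimage hα)
  rw [← Subgroup.map_le_iff_le_comap, Subgroup.map_commutator]
  exact (Subgroup.commutator_mono (Subgroup.map_le_iff_le_comap.2 hAC)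
    (Subgroup.map_le_iff_le_comap.2 hBD)).trans (Subgroup.le_topologicalClosure _)

/-- The abelianization of a closed normal subgroup of a free pro-`p` group is torsion-free. -/
theorem IsFreeProPOfFiniteRank.mem_closure_commutator_of_pow_mem [Fact p.Prime]
    (hF : IsFreeProPOfFiniteRank p F₁) {N : Subgroup F₁} [N.Normal] (hN : IsClosed (N : Set F₁))
    {x : F₁} (hx : x ∈ N) (hxp : x ^ p ∈ ⁅N, N⁆.topologicalClosure) :
    x ∈ ⁅N, N⁆.topologicalClosure := by
  have : ⁅N, N⁆.topologicalClosure.Normal := Subgroup.is_normal_topologicalClosure _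
  refine mem_of_pow_mem_of_charsLift hN (fun k θ hθ _ => ?_)
    (hF.1.charsSeparate (Subgroup.topologicalClosure_minimal _ (Subgroup.commutator_le_left N N) hN)
      (Subgroup.le_topologicalClosure _) (Subgroup.isClosed_topologicalClosure _)) hx hxp
  obtain ⟨ψ, hψ, hψθ⟩ := (hF.hasPLifting N).exists_isCharOn (pow_dvd_pow p k.le_succ) hθ
  exact ⟨ψ, hψ, fun n hn x hx => hψ.map_conj hx hn, hψθ⟩

/-- Let `γ` be an endomorphism of `F` that is the identity modulo a normal subgroup `R` of `N`. Then
`γ` induces the identity on the image of `[N, N]` modulo `[R, N]`: the deviation `n⁻¹ γ(n)` is a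
homomorphism from `N` to the abelian group `R / [R, N]`. -/
theorem inv_mul_map_mem_of_mem_closure_commutator {R N : Subgroup F₁} [R.Normal] [N.Normal]
    (hRN : R ≤ N) (hN : IsClosed (N : Set F₁)) {γ : F₁ →* F₁} (hγ : Continuous γ)
    (hγR : ∀ x, x⁻¹ * γ x ∈ R) {x : F₁} (hx : x ∈ ⁅N, N⁆.topologicalClosure) :
    x⁻¹ * γ x ∈ ⁅R, N⁆.topologicalClosure := by
  set K := ⁅R, N⁆.topologicalClosure with hK
  have hKn : K.Normal := Subgroup.is_normal_topologicalClosure _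
  have hKle : ⁅R, N⁆ ≤ K := Subgroup.le_topologicalClosure _
  let q := QuotientGroup.mk' K
  have hcomm : ∀ r ∈ R, ∀ n ∈ N, q r * q n = q n * q r := by
    intro r hr n hn
    rw [← map_mul, ← map_mul]
    refine (QuotientGroup.eq (s := K)).2 (hKle ?_)
    rw [Subgroup.commutator_comm]
    have := Subgroup.commutator_mem_commutator (N.inv_mem hn) (R.inv_mem hr)
    convert this using 1
    simp [commutatorElement_def, mul_assoc]
  let δ : N →* F₁ ⧸ K := MonoidHom.mk' (fun n => q ((n : F₁)⁻¹ * γ n)) fun a b => by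
    have h1 := hcomm _ (hγR a) b⁻¹ (N.inv_mem b.2)
    rw [← map_mul, ← map_mul] at h1
    have h2 : ((a * b : N) : F₁)⁻¹ * γ ((a * b : N) : F₁) =
        ((b : F₁)⁻¹ * ((a : F₁)⁻¹ * γ a)) * γ b := by
      rw [Subgroup.coe_mul, map_mul]; group
    rw [h2, map_mul, ← h1, ← map_mul, ← map_mul]
    congr 1
    group
  let E : Subgroup F₁ := δ.ker.map N.subtype
  have hE : (E : Set F₁) = {x | x ∈ N ∧ x⁻¹ * γ x ∈ K} := by
    ext x
    constructor
    · rintro ⟨n, hn, rfl⟩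
      exact ⟨n.2, (QuotientGroup.eq_one_iff _).1 hn⟩
    · rintro ⟨hx, hxK⟩
      exact ⟨⟨x, hx⟩, (QuotientGroup.eq_one_iff _).2 hxK, rfl⟩
  have hEc : IsClosed (E : Set F₁) := by
    rw [hE]
    have hc : Continuous fun x : F₁ => x⁻¹ * γ x := by fun_prop
    exact hN.inter ((Subgroup.isClosed_topologicalClosure ⁅R, N⁆).preimage hc)
  have hle : ⁅N, N⁆ ≤ E := by
    rw [Subgroup.commutator_le]
    intro a ha b hb
    let a' : N := ⟨a, ha⟩
    let b' : N := ⟨b, hb⟩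
    refine ⟨a' * b' * a'⁻¹ * b'⁻¹, ?_, rfl⟩
    have hab : δ a' * δ b' = δ b' * δ a' := hcomm _ (hγR a) _ (hRN (hγR b))
    change δ (a' * b' * a'⁻¹ * b'⁻¹) = 1
    rw [map_mul, map_mul, map_mul, hab, map_inv, map_inv]
    group
  have hxE : x ∈ (E : Set F₁) := Subgroup.topologicalClosure_minimal _ hle hEc hx
  rw [hE] at hxE
  exact hxE.2

/-- Quasirationality depends only on the group presented. With lifts `α : F₁ → F₂` and
`β : F₂ → F₁` of the identity of `G`, an element `x` of `R₂` of order `p` modulo `K₂ = [R₂, N₂]` is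
mapped to `K₂` by `α ∘ β`; as `x` is trivial in the torsion-free group `N₂ / [N₂, N₂]`, it is
congruent to `α (β x)` modulo `K₂`. -/
theorem IsProPQuasirational.of_presentation [Fact p.Prime] {G : Type u} [Group G]
    [TopologicalSpace G] [IsTopologicalGroup G] {π₁ : F₁ →* G} {π₂ : F₂ →* G} (hG : IsProP p G)
    (hF₁ : IsFreeProPOfFiniteRank p F₁) (hF₂ : IsFreeProPOfFiniteRank p F₂)
    (hπ₁ : Continuous π₁) (hs₁ : Function.Surjective π₁) (hπ₂ : Continuous π₂)
    (hs₂ : Function.Surjective π₂) (hqr : IsProPQuasirational p π₁.ker) :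
    IsProPQuasirational p π₂.ker := by
  intro n hn x hx hxp
  obtain ⟨α, hα, hαπ⟩ := hF₁.exists_lift hF₂.1 hG hπ₁ hπ₂ hs₂
  obtain ⟨β, hβ, hβπ⟩ := hF₂.exists_lift hF₁.1 hG hπ₂ hπ₁ hs₁
  have hker : π₂.ker ≤ π₁.ker.comap β := fun y hy => (hβπ y).trans hy
  have hker' : π₁.ker ≤ π₂.ker.comap α := fun y hy => (hαπ y).trans hy
  have hN : π₂.ker ⊔ proPZassenhaus p F₂ n ≤ (π₁.ker ⊔ proPZassenhaus p F₁ n).comap β :=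
    sup_le (hker.trans (Subgroup.comap_mono le_sup_left)) fun y hy =>
      (le_sup_right : _ ≤ π₁.ker ⊔ proPZassenhaus p F₁ n) (map_mem_proPZassenhaus hβ hy)
  have hN' : π₁.ker ⊔ proPZassenhaus p F₁ n ≤ (π₂.ker ⊔ proPZassenhaus p F₂ n).comap α :=
    sup_le (hker'.trans (Subgroup.comap_mono le_sup_left)) fun y hy =>
      (le_sup_right : _ ≤ π₂.ker ⊔ proPZassenhaus p F₂ n) (map_mem_proPZassenhaus hα hy)
  have hβx : β x ∈ ⁅π₁.ker, π₁.ker ⊔ proPZassenhaus p F₁ n⁆.topologicalClosure := by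
    refine hqr n hn _ (hker hx) ?_
    rw [← map_pow]
    exact closure_commutator_le_comap hβ hker hN hxp
  have hαβx := closure_commutator_le_comap hα hker' hN' hβx
  have := proPZassenhaus_normal (F := F₂) p n
  set N := π₂.ker ⊔ proPZassenhaus p F₂ n with hNdef
  have hNc : IsClosed (N : Set F₂) := by
    have := hF₂.1.compact
    have := hF₂.1.hausdorff
    have := hG.hausdorff
    have h1 : IsClosed (π₂.ker : Set F₂) := isClosed_singleton.preimage hπ₂
    rw [hNdef, Subgroup.mul_normal]
    exact (h1.isCompact.mul (isClosed_proPZassenhaus p n).isCompact).isClosed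
  have hxN : x ∈ ⁅N, N⁆.topologicalClosure :=
    hF₂.mem_closure_commutator_of_pow_mem hNc ((le_sup_left : π₂.ker ≤ N) hx)
      (Subgroup.topologicalClosure_mono (Subgroup.commutator_mono le_sup_left le_rfl) hxp)
  have hdev : x⁻¹ * α (β x) ∈ ⁅π₂.ker, N⁆.topologicalClosure :=
    inv_mul_map_mem_of_mem_closure_commutator (γ := α.comp β) le_sup_left hNc (hα.comp hβ)
      (fun y => by simp [MonoidHom.mem_ker, hαπ, hβπ]) hxN
  have := Subgroup.mul_mem _ (Subgroup.mem_comap.1 hαβx) (Subgroup.inv_mem _ hdev)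
  simpa using this

end Independence

/-! ### Conjugacy of inverse elements in free groups -/

section FreeGroup

/-- In a free group generated by `a` and `g` with `g a g⁻¹ = a⁻¹`, the image of `a` in the
abelianization is trivial, so that the rank is at most one and `a = 1`. -/
theorem FreeGroup.eq_one_of_conj_eq_inv_of_closure {ι : Type*} {a g : FreeGroup ι}
    (hgen : Subgroup.closure {a, g} = ⊤) (h : g * a * g⁻¹ = a⁻¹) : a = 1 := by
  classical
  have hzero : ∀ w : FreeGroup ι →* Multiplicative ℤ, w a = 1 := by
    intro w
    have h1 := congrArg w h
    rw [_root_.map_mul, _root_.map_mul, _root_.map_inv, _root_.map_inv, mul_comm (w g),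
      mul_inv_cancel_right] at h1
    have h2 : (w a).toAdd = -(w a).toAdd := congrArg Multiplicative.toAdd h1
    have h3 : (w a).toAdd = 0 := by omega
    exact h3
  have htriv : ∀ w : FreeGroup ι →* Multiplicative ℤ, w g = 1 → w = 1 := by
    intro w hw
    refine MonoidHom.eq_of_eqOn_dense hgen ?_
    rintro x (rfl | rfl)
    · exact hzero w
    · exact hw
  have hsub : Subsingleton ι := by
    refine ⟨fun i j => by_contra fun hij => ?_⟩
    let c : ι → FreeGroup ι →* Multiplicative ℤ := fun i =>
      FreeGroup.lift fun k => if k = i then Multiplicative.ofAdd 1 else 1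
    have hw := htriv (c i ^ (c j g).toAdd * (c j ^ (c i g).toAdd)⁻¹) (by
      refine Multiplicative.toAdd.injective ?_
      change (c j g).toAdd • (c i g).toAdd + -((c i g).toAdd • (c j g).toAdd) = 0
      simp [mul_comm])
    have hj : (c j g).toAdd = 0 := by
      have h1 := congrArg Multiplicative.toAdd (DFunLike.congr_fun hw (FreeGroup.of i))
      change (c j g).toAdd • (c i (FreeGroup.of i)).toAdd +
        -((c i g).toAdd • (c j (FreeGroup.of i)).toAdd) = 0 at h1
      simpa [c, hij] using h1
    have h1 := congrArg Multiplicative.toAdd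
      (DFunLike.congr_fun (htriv (c j) hj) (FreeGroup.of j))
    simp [c] at h1
  rcases isEmpty_or_nonempty ι with hι | ⟨⟨i⟩⟩
  · exact Subsingleton.elim _ _
  · have : Unique ι := { default := i, uniq := fun _ => Subsingleton.elim _ _ }
    exact (FreeGroup.mulEquivIntOfUnique (α := ι)).injective
      ((hzero (FreeGroup.mulEquivIntOfUnique (α := ι)).toMonoidHom).trans (_root_.map_one _).symm)

/-- A nontrivial element of a free group is not conjugate to its inverse. -/
theorem FreeGroup.eq_one_of_conj_eq_inv {X : Type*} {a g : FreeGroup X}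
    (h : g * a * g⁻¹ = a⁻¹) : a = 1 := by
  let H := Subgroup.closure {a, g}
  have ha : a ∈ H := Subgroup.subset_closure (by simp)
  have hg : g ∈ H := Subgroup.subset_closure (by simp)
  let e : H ≃* FreeGroup (IsFreeGroup.Generators H) := IsFreeGroup.toFreeGroup H
  have hgen : Subgroup.closure {(⟨a, ha⟩ : H), ⟨g, hg⟩} = ⊤ := by
    rw [← Subgroup.closure_closure_coe_preimage (k := {a, g})]
    congr 1
    ext x
    simp [Subtype.ext_iff]
  have h1 : e ⟨a, ha⟩ = 1 := by
    refine FreeGroup.eq_one_of_conj_eq_inv_of_closure (g := e ⟨g, hg⟩) ?_ ?_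
    · have := congrArg (Subgroup.map e.toMonoidHom) hgen
      rw [MonoidHom.map_closure, Subgroup.map_top_of_surjective _ e.surjective] at this
      rw [← this]
      congr 1
      simp [Set.image_pair]
    · rw [← _root_.map_mul, ← _root_.map_inv, ← _root_.map_inv, ← _root_.map_mul]
      exact congrArg e (Subtype.ext h)
  rw [map_eq_one_iff e e.injective] at h1
  exact congrArg Subtype.val h1

/-- In a free group there is a conjugation-invariant choice of one element out of each pair
`a, a⁻¹` of nontrivial inverse elements. -/
theorem FreeGroup.exists_orientation (X : Type*) : ∃ O : Set (FreeGroup X),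
    (∀ x, ∀ a ∈ O, x * a * x⁻¹ ∈ O) ∧ ∀ a, a ≠ 1 → (a⁻¹ ∈ O ↔ a ∉ O) := by
  classical
  let _ : LinearOrder (ConjClasses (FreeGroup X)) := IsWellOrder.linearOrder WellOrderingRel
  refine ⟨{a | ConjClasses.mk a < ConjClasses.mk a⁻¹}, fun x a ha => ?_, fun a ha => ?_⟩
  · have h1 : ConjClasses.mk (x * a * x⁻¹) = ConjClasses.mk a :=
      ConjClasses.mk_eq_mk_iff_isConj.2 (isConj_iff.2 ⟨x⁻¹, by group⟩)
    have h2 : ConjClasses.mk (x * a * x⁻¹)⁻¹ = ConjClasses.mk a⁻¹ :=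
      ConjClasses.mk_eq_mk_iff_isConj.2 (isConj_iff.2 ⟨x⁻¹, by group⟩)
    change ConjClasses.mk (x * a * x⁻¹) < ConjClasses.mk (x * a * x⁻¹)⁻¹
    rw [h1, h2]
    exact ha
  · have hne : ConjClasses.mk a ≠ ConjClasses.mk a⁻¹ := by
      intro h
      obtain ⟨g, hg⟩ := isConj_iff.1 (ConjClasses.mk_eq_mk_iff_isConj.1 h)
      exact ha (FreeGroup.eq_one_of_conj_eq_inv hg)
    change ConjClasses.mk a⁻¹ < ConjClasses.mk a⁻¹⁻¹ ↔ ¬ ConjClasses.mk a < ConjClasses.mk a⁻¹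
    rw [inv_inv, not_lt]
    exact ⟨le_of_lt, fun h => lt_of_le_of_ne h hne.symm⟩

/-- Free groups have the lifting property. -/
theorem hasPLifting_of_isFreeGroup (p : ℕ) (L : Type u) [Group L] [IsFreeGroup L]
    [TopologicalSpace L] [DiscreteTopology L] : HasPLifting p L := by
  intro E B _ _ _ _ π hπ φ _
  choose c hc using fun i : IsFreeGroup.Generators L => hπ (φ (IsFreeGroup.of i))
  refine ⟨IsFreeGroup.lift c, IsLocallyConstant.of_discrete _, fun x => ?_⟩
  have : π.comp (IsFreeGroup.lift c) = φ := IsFreeGroup.ext_hom fun i => by simp [hc]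
  exact DFunLike.congr_fun this x

end FreeGroup

/-! ### Combinatorially aspherical presentations -/

section Discrete

variable {F : Type u} [Group F]

theorem conj_mem_relatorConjugates {S : Set F} (x : F) {a : F} (ha : a ∈ relatorConjugates S) :
    x * a * x⁻¹ ∈ relatorConjugates S := by
  obtain ⟨r, hr, h⟩ := ha
  have hx : IsConj a (x * a * x⁻¹) := isConj_iff.2 ⟨x, rfl⟩
  exact ⟨r, hr, h.imp (fun h => h.trans hx) fun h => h.trans hx⟩

theorem conj_mem_relatorConjugates_iff {S : Set F} (x : F) {a : F} :
    x * a * x⁻¹ ∈ relatorConjugates S ↔ a ∈ relatorConjugates S := by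
  refine ⟨fun h => ?_, conj_mem_relatorConjugates x⟩
  have := conj_mem_relatorConjugates x⁻¹ h
  simpa [mul_assoc] using this

theorem inv_mem_relatorConjugates {S : Set F} {a : F} (ha : a ∈ relatorConjugates S) :
    a⁻¹ ∈ relatorConjugates S := by
  obtain ⟨r, hr, h⟩ := ha
  have hinv : ∀ {x y : F}, IsConj x y → IsConj x⁻¹ y⁻¹ := by
    intro x y hxy
    obtain ⟨c, rfl⟩ := isConj_iff.1 hxy
    exact isConj_iff.2 ⟨c, by group⟩
  refine ⟨r, hr, h.symm.imp (fun h => ?_) hinv⟩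
  simpa using hinv h

theorem relatorConjugates_subset_normalClosure (S : Set F) :
    relatorConjugates S ⊆ Subgroup.normalClosure S := by
  rintro a ⟨r, hr, h⟩
  have hrS := Subgroup.subset_normalClosure hr
  rcases h with h | h <;> obtain ⟨c, rfl⟩ := isConj_iff.1 h
  · exact Subgroup.normalClosure_normal.conj_mem _ hrS c
  · exact Subgroup.normalClosure_normal.conj_mem _ (Subgroup.inv_mem _ hrS) c

theorem conjugates_subset_relatorConjugates (S : Set F) : conjugates S ⊆ relatorConjugates S := by
  rintro _ ⟨r, hr, f, rfl⟩
  exact ⟨r, hr, Or.inl (isConj_iff.2 ⟨f, rfl⟩)⟩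

theorem exists_list_prod_eq_of_mem_normalClosure {S : Set F} {x : F}
    (hx : x ∈ Subgroup.normalClosure S) :
    ∃ l : List F, (∀ a ∈ l, a ∈ relatorConjugates S) ∧ l.prod = x := by
  rw [← closure_conjugates] at hx
  rw [← Subgroup.mem_toSubmonoid, Subgroup.closure_toSubmonoid] at hx
  obtain ⟨l, hl, rfl⟩ := Submonoid.exists_list_of_mem_closure hx
  refine ⟨l, fun a ha => ?_, rfl⟩
  rcases hl a ha with h | h
  · exact conjugates_subset_relatorConjugates S h
  · simpa using inv_mem_relatorConjugates (conjugates_subset_relatorConjugates S h)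

/-- Peiffer operations preserve the parity of the length. Hence `1` is not a conjugate of a
relator in a combinatorially aspherical presentation. -/
theorem IsCombinatoriallyAspherical.ne_one {S : Set F} (hS : IsCombinatoriallyAspherical S) {a : F}
    (ha : a ∈ relatorConjugates S) : a ≠ 1 := by
  rintro rfl
  have h := hS [1] (by simpa using ha) (by simp)
  have key : ∀ l l' : List F, Relation.EqvGen (PeifferStep S) l l' →
      l.length % 2 = l'.length % 2 := by
    intro l l' h
    induction h with
    | rel l l' h => cases h <;> (simp; try omega)
    | refl => rfl
    | symm _ _ _ ih => exact ih.symm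
    | trans _ _ _ _ _ ih ih' => exact ih.trans ih'
  simpa using key _ _ h

variable {C : Type*} [AddCommGroup C]

/-- An odd function on the conjugates of relators, invariant under conjugation by the normal
closure, has the same sum over two Peiffer equivalent sequences. -/
theorem sum_map_eq_of_eqvGen_peifferStep {S : Set F} {h : F → C}
    (hodd : ∀ a ∈ relatorConjugates S, h a⁻¹ = -h a)
    (hinv : ∀ x ∈ Subgroup.normalClosure S, ∀ a ∈ relatorConjugates S, h (x * a * x⁻¹) = h a)
    {l l' : List F} (hll' : Relation.EqvGen (PeifferStep S) l l') :
    ((∀ a ∈ l, a ∈ relatorConjugates S) ↔ ∀ a ∈ l', a ∈ relatorConjugates S) ∧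
      ((∀ a ∈ l, a ∈ relatorConjugates S) → (l.map h).sum = (l'.map h).sum) := by
  have hR := relatorConjugates_subset_normalClosure S
  induction hll' with
  | rel l l' hstep =>
    cases hstep with
    | exchange l₁ l₂ a b =>
      constructor
      · simp only [List.mem_append, List.mem_cons, or_imp, forall_and, forall_eq,
          conj_mem_relatorConjugates_iff]
        tauto
      · intro hl
        have ha : a ∈ relatorConjugates S := hl a (by simp)
        have hb : b ∈ relatorConjugates S := hl b (by simp)
        simp only [List.map_append, List.map_cons, List.sum_append, List.sum_cons,
          hinv a (hR ha) b hb]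
        abel
    | exchange' l₁ l₂ a b =>
      have hconj : b⁻¹ * a * b ∈ relatorConjugates S ↔ a ∈ relatorConjugates S := by
        simpa using conj_mem_relatorConjugates_iff (S := S) b⁻¹ (a := a)
      constructor
      · simp only [List.mem_append, List.mem_cons, or_imp, forall_and, forall_eq, hconj]
        tauto
      · intro hl
        have ha : a ∈ relatorConjugates S := hl a (by simp)
        have hb : b ∈ relatorConjugates S := hl b (by simp)
        have hh : h (b⁻¹ * a * b) = h a := by
          simpa using hinv b⁻¹ (Subgroup.inv_mem _ (hR hb)) a ha
        simp only [List.map_append, List.map_cons, List.sum_append, List.sum_cons, hh]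
        abel
    | deletion l₁ l₂ a ha =>
      constructor
      · simp only [List.mem_append, List.mem_cons, or_imp, forall_and, forall_eq, ha,
          inv_mem_relatorConjugates ha]
        tauto
      · intro _
        simp only [List.map_append, List.map_cons, List.sum_append, List.sum_cons, hodd a ha]
        abel
  | refl => exact ⟨Iff.rfl, fun _ => rfl⟩
  | symm _ _ _ ih => exact ⟨ih.1.symm, fun hl => (ih.2 (ih.1.2 hl)).symm⟩
  | trans _ _ _ _ _ ih ih' =>
    exact ⟨ih.1.trans ih'.1, fun hl => (ih.2 hl).trans (ih'.2 (ih.1.1 hl))⟩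

/-- In a combinatorially aspherical presentation, odd invariant functions on the conjugates of
relators extend to homomorphisms on the normal closure. -/
theorem IsCombinatoriallyAspherical.exists_isCharOn [TopologicalSpace F] [DiscreteTopology F]
    {S : Set F} (hS : IsCombinatoriallyAspherical S) {h : F → C}
    (hodd : ∀ a ∈ relatorConjugates S, h a⁻¹ = -h a)
    (hinv : ∀ x ∈ Subgroup.normalClosure S, ∀ a ∈ relatorConjugates S, h (x * a * x⁻¹) = h a) :
    ∃ φ : F → C, IsCharOn (Subgroup.normalClosure S) φ ∧ ∀ a ∈ relatorConjugates S, φ a = h a := by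
  classical
  have key : ∀ l l' : List F, (∀ a ∈ l, a ∈ relatorConjugates S) →
      (∀ a ∈ l', a ∈ relatorConjugates S) → l.prod = l'.prod →
      (l.map h).sum = (l'.map h).sum := by
    intro l l' hl hl' hprod
    have hinvsum : ∀ m : List F, (∀ a ∈ m, a ∈ relatorConjugates S) →
        ((m.map fun a => a⁻¹).reverse.map h).sum = -(m.map h).sum := by
      intro m hm
      induction m with
      | nil => simp
      | cons a m ih =>
        have h1 := ih fun b hb => hm b (by simp [hb])
        have h2 := hodd a (hm a (by simp))
        simp only [List.map_cons, List.reverse_cons, List.map_append, List.sum_append, h1,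
          List.sum_cons, List.map_nil, List.sum_nil, h2]
        abel
    have h1 := hS (l ++ (l'.map fun a => a⁻¹).reverse) (by
      intro a ha
      rw [List.mem_append, List.mem_reverse, List.mem_map] at ha
      rcases ha with ha | ⟨b, hb, rfl⟩
      · exact hl a ha
      · exact inv_mem_relatorConjugates (hl' b hb)) (by
      rw [List.prod_append, hprod, ← List.prod_inv_reverse, mul_inv_cancel])
    have h2 := (sum_map_eq_of_eqvGen_peifferStep hodd hinv h1).2
      ((sum_map_eq_of_eqvGen_peifferStep hodd hinv h1).1.2 (by simp))
    rw [List.map_append, List.sum_append, hinvsum l' hl', List.map_nil, List.sum_nil,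
      ← sub_eq_add_neg, sub_eq_zero] at h2
    exact h2
  choose! L hL hLprod using fun x (hx : x ∈ Subgroup.normalClosure S) =>
    exists_list_prod_eq_of_mem_normalClosure hx
  refine ⟨fun x => ((L x).map h).sum, ⟨fun x hx y hy => ?_, ?_⟩, fun a ha => ?_⟩
  · have hxy := Subgroup.mul_mem _ hx hy
    rw [← List.sum_append, ← List.map_append]
    refine key _ _ (hL _ hxy) (fun a ha => ?_) ?_
    · rcases List.mem_append.1 ha with ha | ha
      · exact hL x hx a ha
      · exact hL y hy a ha
    · rw [List.prod_append, hLprod _ hxy, hLprod x hx, hLprod y hy]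
  · exact locConstOn_iff.2 (IsLocallyConstant.of_discrete _)
  · have haR := relatorConjugates_subset_normalClosure S ha
    have := key (L a) [a] (hL a haR) (by simpa using ha) (by simp [hLprod a haR])
    simpa using this

/-- The coinvariants of the relation module under a subgroup of finite index form a finitely
generated group, if there are finitely many relators. -/
theorem fg_quotient_commutator {S : Set F} (hS : S.Finite) {N : Subgroup F} [N.Normal]
    [hN : Finite (F ⧸ N)] :
    Group.FG (Subgroup.normalClosure S ⧸
      (⁅Subgroup.normalClosure S, N⁆).subgroupOf (Subgroup.normalClosure S)) := by
  set R := Subgroup.normalClosure S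
  set K := ⁅R, N⁆
  have hKn : K.Normal := Subgroup.commutator_normal R N
  have : Finite S := hS
  let c : S × F ⧸ N → R := fun a =>
    ⟨a.2.out * a.1 * a.2.out⁻¹, Subgroup.normalClosure_normal.conj_mem _
      (Subgroup.subset_normalClosure a.1.2) _⟩
  let q := QuotientGroup.mk' (K.subgroupOf R)
  refine Group.fg_iff.2 ⟨Set.range (q ∘ c), ?_, Set.finite_range _⟩
  have hle : R ≤ ((Subgroup.closure (Set.range (q ∘ c))).comap q).map R.subtype := by
    change Subgroup.normalClosure S ≤ _
    rw [← closure_conjugates, Subgroup.closure_le]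
    rintro _ ⟨r, hr, f, rfl⟩
    have hrR : r ∈ R := Subgroup.subset_normalClosure hr
    refine ⟨⟨f * r * f⁻¹, Subgroup.normalClosure_normal.conj_mem _ hrR f⟩, ?_, rfl⟩
    let y : F ⧸ N := QuotientGroup.mk f
    have heq : q ⟨f * r * f⁻¹, Subgroup.normalClosure_normal.conj_mem _ hrR f⟩ =
        (q ∘ c) (⟨r, hr⟩, y) := by
      refine Eq.symm ((QuotientGroup.eq (s := K.subgroupOf R)).2 ?_)
      change (y.out * r * y.out⁻¹)⁻¹ * (f * r * f⁻¹) ∈ K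
      have hm : y.out⁻¹ * f ∈ N := by
        rw [← QuotientGroup.eq, QuotientGroup.out_eq']
      have h1 := hKn.conj_mem _
        (Subgroup.commutator_mem_commutator (R.inv_mem hrR) hm) y.out
      convert h1 using 1
      simp [commutatorElement_def, mul_assoc]
    rw [SetLike.mem_coe, Subgroup.mem_comap, heq]
    exact Subgroup.subset_closure ⟨_, rfl⟩
  rw [eq_top_iff]
  intro z _
  obtain ⟨x, rfl⟩ := QuotientGroup.mk'_surjective (K.subgroupOf R) z
  obtain ⟨x', hx', hxx'⟩ := hle x.2
  have : x' = x := Subtype.ext hxx'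
  rw [← this]
  exact hx'

variable {X : Type u} [Finite X]

/-- Subpresentations of combinatorially aspherical presentations are quasirational. -/
theorem IsCombinatoriallyAspherical.isQuasirational {S S' : Set (FreeGroup X)} (hfin : S.Finite)
    (hS : IsCombinatoriallyAspherical S) (hS' : S' ⊆ S) :
    IsQuasirational (Subgroup.normalClosure S') := by
  classical
  intro p hp n _ x hx hxp
  have : Fact p.Prime := ⟨hp⟩
  let _ : TopologicalSpace (FreeGroup X) := ⊥
  have : DiscreteTopology (FreeGroup X) := ⟨rfl⟩
  obtain ⟨O, hOconj, hO⟩ := FreeGroup.exists_orientation X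
  set R' := Subgroup.normalClosure S' with hR'def
  set R := Subgroup.normalClosure S with hRdef
  set N := R' ⊔ zassenhaus p (FreeGroup X) n with hNdef
  have hR'n : R'.Normal := Subgroup.normalClosure_normal
  have hRn : R.Normal := Subgroup.normalClosure_normal
  have hR'R : R' ≤ R := Subgroup.normalClosure_mono hS'
  have hsub : relatorConjugates S' ⊆ relatorConjugates S := fun a ⟨r, hr, h⟩ => ⟨r, hS' hr, h⟩
  have hne : ∀ a ∈ relatorConjugates S, a ≠ 1 := fun a => hS.ne_one
  have : Finite (FreeGroup X ⧸ zassenhaus p (FreeGroup X) n) := finite_quotient_zassenhaus n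
  have : (zassenhaus p (FreeGroup X) n).FiniteIndex := Subgroup.finiteIndex_of_finite_quotient
  have : N.FiniteIndex := Subgroup.finiteIndex_of_le le_sup_right
  -- the oriented conjugates of the relators in `S'`
  set A := relatorConjugates S' ∩ O with hAdef
  have hAconj : ∀ x, ∀ a ∈ A, x * a * x⁻¹ ∈ A := fun x a ha =>
    ⟨conj_mem_relatorConjugates x ha.1, hOconj x a ha.2⟩
  have hAconj_iff : ∀ x a, x * a * x⁻¹ ∈ A ↔ a ∈ A := fun x a =>
    ⟨fun h => by simpa [mul_assoc] using hAconj x⁻¹ _ h, hAconj x a⟩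
  have hAR' : A ⊆ R' := fun a ha => relatorConjugates_subset_normalClosure S' ha.1
  have hgen : R' ≤ (Subgroup.closure A).topologicalClosure := by
    refine le_trans ?_ (Subgroup.le_topologicalClosure _)
    rw [hR'def, ← closure_conjugates, Subgroup.closure_le]
    intro a ha
    have ha' := conjugates_subset_relatorConjugates S' ha
    by_cases haO : a ∈ O
    · exact Subgroup.subset_closure ⟨ha', haO⟩
    · rw [SetLike.mem_coe, ← Subgroup.inv_mem_iff]
      exact Subgroup.subset_closure
        ⟨inv_mem_relatorConjugates ha', (hO a (hne a (hsub ha'))).2 haO⟩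
  -- the odd extension of `h` from `A` to the conjugates of the relators in `S'`, and by `0`
  -- to those of the other relators
  have hbase : CharExtends A R p := by
    intro h _ hinv
    obtain ⟨φ, hφ, hφA⟩ := hS.exists_isCharOn
      (h := fun a => if a ∈ A then h a else if a⁻¹ ∈ A then -h a⁻¹ else 0) (by
        intro a ha
        have hnot : a⁻¹ ∈ A → a ∉ A := fun h1 h2 => (hO a (hne a ha)).1 h1.2 h2.2
        by_cases h1 : a ∈ A
        · have h2 : a⁻¹ ∉ A := fun h => hnot h h1
          simp [h1, h2]
        · by_cases h2 : a⁻¹ ∈ A <;> simp [h1, h2]) (by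
        intro x hx a ha
        have hc : (x * a * x⁻¹)⁻¹ = x * a⁻¹ * x⁻¹ := by group
        simp only [hc, hAconj_iff]
        by_cases h1 : a ∈ A
        · simp [h1, hinv x hx a h1]
        · by_cases h2 : a⁻¹ ∈ A
          · simp [h1, h2, hinv x hx _ h2]
          · simp [h1, h2])
    exact ⟨φ, hφ, fun a ha => by rw [hφA a (hsub ha.1), if_pos ha]⟩
  have hproj : ∀ M : Subgroup (FreeGroup X), HasPLifting p M := fun M =>
    hasPLifting_of_isFreeGroup p M
  set L := R ⊓ N
  have hR'L : R' ≤ L := le_inf hR'R le_sup_left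
  have hLn : ∀ x ∈ R, ∀ l ∈ L, x * l * x⁻¹ ∈ L := fun x _ l hl =>
    (inferInstance : L.Normal).conj_mem l hl x
  obtain ⟨m, hm⟩ : ∃ m, L.relIndex R = p ^ m := by
    have : (L.subgroupOf R).FiniteIndex := by
      rw [Subgroup.inf_subgroupOf_left]
      infer_instance
    have hP : IsPGroup p (R ⧸ L.subgroupOf R) := by
      intro x
      induction x using QuotientGroup.induction_on with | _ x
      refine ⟨n, (QuotientGroup.eq_one_iff (N := L.subgroupOf R) (x ^ p ^ n)).2 ?_⟩
      exact ⟨R.pow_mem x.2 _, (le_sup_right : _ ≤ N) (pow_mem_zassenhaus (x : FreeGroup X) n)⟩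
    exact IsPGroup.iff_card.1 hP
  have hL : CharExtends A L p :=
    CharExtends.of_relIndex_eq_prime_pow (hAR'.trans hR'L) m R inf_le_left hLn hm
      (by
        rw [nhdsWithin, nhds_discrete]
        exact mem_inf_of_left (mem_pure.2 L.one_mem))
      (fun M _ _ => hproj M) (fun x _ a ha => hAconj x a ha) hbase
  have hlift : CharsLift p R' N :=
    charsLift_of_charExtends (isClosed_discrete _) hAR' hgen hAconj fun k θ _ hinv =>
      ⟨L, hR'L, hL.prime_pow (hproj L) (hAR'.trans hR'L) _, fun l hl x hx => hinv l hl.2 x hx⟩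
  have hcl : ⁅R', N⁆.topologicalClosure = ⁅R', N⁆ :=
    SetLike.ext' (by rw [Subgroup.topologicalClosure_coe, closure_discrete])
  have hsep : CharsSeparate p R' ⁅R', N⁆ := by
    intro y hy hyK hyp
    have hfg := fg_quotient_commutator (hfin.subset hS') (N := N)
    obtain ⟨k, θ, hθ, hθK, hθy⟩ := exists_isCharOn_ne_zero
      (Subgroup.commutator_mono (le_refl R') (le_sup_left : R' ≤ N))
      (by
        rw [nhdsWithin, nhds_discrete]
        exact mem_inf_of_left (mem_pure.2 ⁅R', N⁆.one_mem)) hfg hy hyK (m := 1) (by simpa using hyp)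
    exact ⟨k, θ, hθ, fun z hz => hθK z (Subgroup.commutator_le_left R' N hz) hz, hθy⟩
  have := mem_of_pow_mem_of_charsLift (isClosed_discrete _) hlift (by rwa [hcl]) hx
    (by rwa [hcl])
  rwa [hcl] at this

end Discrete

theorem mainTheorem5 :
    -- (i), discrete presentations
    (∀ (X : Type u) [Finite X] (S : Set (FreeGroup X)), S.Finite →
      IsCombinatoriallyAspherical S →
      IsQuasirational (Subgroup.normalClosure S) ∧
      ∀ S' : Set (FreeGroup X), S' ⊆ S → IsQuasirational (Subgroup.normalClosure S')) ∧
    -- (i), pro-p presentations, with a set of relators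
    (∀ (p : ℕ) [Fact p.Prime] (F : Type u) [Group F] [TopologicalSpace F] [IsTopologicalGroup F]
      (S : Set F), IsFreeProPOfFiniteRank p F → S.Finite → IsProPAspherical p S →
      IsProPQuasirational p (closedNormalClosure S) ∧
      ∀ S' : Set F, S' ⊆ S → IsProPQuasirational p (closedNormalClosure S')) ∧
    -- (i), pro-p presentations with a permutational relation module, no relators chosen
    (∀ (p : ℕ) [Fact p.Prime] (F : Type u) [Group F] [TopologicalSpace F] [IsTopologicalGroup F]
      (R : Subgroup F) [R.Normal], IsFreeProPOfFiniteRank p F → IsClosed (R : Set F) →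
      IsPermutationalRelationModule p R → IsProPQuasirational p R) ∧
    -- (ii)
    (∀ (p : ℕ) [Fact p.Prime]
      (G : Type u) [Group G] [TopologicalSpace G] [IsTopologicalGroup G]
      (F₁ : Type v) [Group F₁] [TopologicalSpace F₁] [IsTopologicalGroup F₁]
      (F₂ : Type w) [Group F₂] [TopologicalSpace F₂] [IsTopologicalGroup F₂]
      (π₁ : F₁ →* G) (π₂ : F₂ →* G),
      IsProP p G → IsFreeProPOfFiniteRank p F₁ → IsFreeProPOfFiniteRank p F₂ →
      Continuous π₁ → Function.Surjective π₁ → Continuous π₂ → Function.Surjective π₂ →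
      IsProPQuasirational p π₁.ker → IsProPQuasirational p π₂.ker) := by
  refine ⟨fun X _ S hfin hS => ⟨hS.isQuasirational hfin subset_rfl,
    fun S' hS' => hS.isQuasirational hfin hS'⟩, ?_, ?_, ?_⟩
  · intro p _ F _ _ _ S hF hfin hS
    have h : ∀ S' ⊆ S, IsProPQuasirational p (closedNormalClosure S') := fun S' hS' =>
      hF.1.isProPQuasirational (isClosed_closedNormalClosure S') (hS.charsLift hF hfin hS')
    exact ⟨h S subset_rfl, h⟩
  · intro p _ F _ _ _ R _ hF hR hperm
    exact hF.1.isProPQuasirational hR (charsLift_of_isPermutational hperm)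
  · intro p _ G _ _ _ F₁ _ _ _ F₂ _ _ _ π₁ π₂ hG hF₁ hF₂ hc₁ hs₁ hc₂ hs₂ hqr
    exact hqr.of_presentation hG hF₁ hF₂ hc₁ hs₁ hc₂ hs₂
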